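/- Let $k$ be a commutative ring and let $\mathcal C$ be a pivotal fusion category over $k$, with chosen duals $X^*$ and left and right (co)evaluations. That is, $\mathcal C$ is a $k$-additive monoidal category (finite direct sums exist, composition and $\otimes$ are $k$-bilinear) in which: every object $X$ has an object $X^*$ that is both a left and a right dual of $X$, and the resulting left and right dual functors coincide as monoidal functors; every object is a finite direct sum of scalar objects (objects $i$ for which $k\to\mathrm{End}(i)$, $a\mapsto a\,\mathrm{id}_i$, is bijective); $\mathrm{Hom}(i,j)=0$ for non-isomorphic scalar objects $i,j$; there are finitely many isomorphism classes of scalar objects; and the unit object $\mathbb 1$ is scalar, so that $\mathrm{End}(\mathbb 1)=k$. Let $I$ be a representative set of scalar objects, that is, a set of scalar objects with $\mathbb 1\in I$ such that every scalar object is isomorphic to exactly one element of $I$. Put $\dim(\mathcal C)=\sum_{i\in I}\dim_l(i)\dim_r(i)\in k$, where $\dim_l$ and $\dim_r$ denote the left and right dimensions. A half braiding of $\mathcal C$ is a pair $(A,\sigma)$ of an object $A$ and a natural isomorphism $\sigma_Y\colon A\otimes Y\to Y\otimes A$ with $\sigma_{Y\otimes Y'}=(\mathrm{id}_Y\otimes\sigma_{Y'})(\sigma_Y\otimes\mathrm{id}_{Y'})$;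 half braidings are the objects of the center $\mathcal Z(\mathcal C)$, whose morphisms $(A,\sigma)\to(A',\sigma')$ are the morphisms $f\colon A\to A'$ with $(\mathrm{id}_Y\otimes f)\sigma_Y=\sigma'_Y(f\otimes\mathrm{id}_Y)$ for all $Y$. (The canonical associativity and unit isomorphisms are suppressed.) For an object $X$ of $\mathcal C$, the free half braiding is $F(X)=(Z(X),\varsigma_X)$ with $Z(X)=\bigoplus_{i\in I}i^*\otimes X\otimes i$, where the component of $\varsigma_{X,Y}\colon Z(X)\otimes Y\to Y\otimes Z(X)$ from $i^*\otimes X\otimes i\otimes Y$ to $Y\otimes j^*\otimes X\otimes j$ is $\sum_\alpha \widehat{q_\alpha}\otimes\mathrm{id}_X\otimes p_\alpha$. Here $(p_\alpha\colon i\otimes Y\to j,\ q_\alpha\colon j\to i\otimes Y)_\alpha$ are the projections and inclusions of the copies of $j$ in a decomposition of $i\otimes Y$ as a direct sum of elements of $I$, and $\widehat{q_\alpha}=(\mathrm{ev}_i\otimes\mathrm{id}_{Y\otimes j^*})(\mathrm{id}_{i^*}\otimes q_\alpha\otimes\mathrm{id}_{j^*})(\mathrm{id}_{i^*}\otimes\mathrm{coev}_j)\colon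 i^*\to Y\otimes j^*$, with $\mathrm{ev}_i\colon i^*\otimes i\to\mathbb 1$ and $\mathrm{coev}_j\colon\mathbb 1\to j\otimes j^*$ the left evaluation and coevaluation; $\varsigma_X$ does not depend on the choice of the decompositions. Then $\dim(\mathcal C)$ is invertible in $k$ if and only if every half braiding of $\mathcal C$ is a retract, in $\mathcal Z(\mathcal C)$, of $F(X)$ for some object $X$ of $\mathcal C$. -/

import Mathlib

open CategoryTheory MonoidalCategory Limits

universe w v u

namespace FusionCenter

section Pivotal

variable {C : Type u} [Category.{v} C] [MonoidalCategory C]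

/-- The dual `f^* : Y' ⟶ X'` of a morphism `f : X ⟶ Y`, computed from left duals `X'` of `X` and
`Y'` of `Y` (evaluations `X' ⊗ X ⟶ 𝟙`, coevaluations `𝟙 ⟶ X ⊗ X'`):
`f^* = (ev_Y ⊗ id) (id ⊗ f ⊗ id) (id ⊗ coev_X)`. -/
def leftMate {X X' Y Y' : C} (pX : ExactPairing X X') (pY : ExactPairing Y Y') (f : X ⟶ Y) :
    Y' ⟶ X' :=
  @rightAdjointMate C _ _ X Y (@HasRightDual.mk C _ _ X X' pX) (@HasRightDual.mk C _ _ Y Y' pY) f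

/-- The dual `f^* : Y' ⟶ X'` of a morphism `f : X ⟶ Y`, computed from right duals `X'` of `X` and
`Y'` of `Y` (evaluations `X ⊗ X' ⟶ 𝟙`, coevaluations `𝟙 ⟶ X' ⊗ X`):
`f^* = (id ⊗ ev_Y) (id ⊗ f ⊗ id) (coev_X ⊗ id)`. -/
def rightMate {X X' Y Y' : C} (pX : ExactPairing X' X) (pY : ExactPairing Y' Y) (f : X ⟶ Y) :
    Y' ⟶ X' :=
  @leftAdjointMate C _ _ X Y (@HasLeftDual.mk C _ _ X X' pX) (@HasLeftDual.mk C _ _ Y Y' pY) f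

variable (C) in
/-- A pivotal category: every object `X` has a dual object `X^*` which is both a left dual and a
right dual of `X`, in such a way that the resulting left and right dual functors coincide as
monoidal functors (on morphisms, and in their monoidal and unit constraints
`Y^* ⊗ X^* ⟶ (X ⊗ Y)^*` and `𝟙 ⟶ 𝟙^*`). -/
class PivotalCategory where
  /-- the dual object `X^*` -/
  dual : C → C
  /-- `X^* ⊗ X ⟶ 𝟙` and `𝟙 ⟶ X ⊗ X^*` -/
  leftPairing (X : C) : ExactPairing X (dual X)
  /-- `X ⊗ X^* ⟶ 𝟙` and `𝟙 ⟶ X^* ⊗ X` -/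
  rightPairing (X : C) : ExactPairing (dual X) X
  dual_map {X Y : C} (f : X ⟶ Y) :
    leftMate (leftPairing X) (leftPairing Y) f = rightMate (rightPairing X) (rightPairing Y) f
  dual_tensor (X Y : C) :
    leftMate (leftPairing (X ⊗ Y))
        (@ExactPairing.tensor C _ _ X Y (dual X) (dual Y) (leftPairing X) (leftPairing Y))
        (𝟙 (X ⊗ Y)) =
      rightMate (rightPairing (X ⊗ Y))
        (@ExactPairing.tensor C _ _ (dual Y) (dual X) Y X (rightPairing Y) (rightPairing X))
        (𝟙 (X ⊗ Y))
  dual_unit :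
    leftMate (leftPairing (𝟙_ C)) exactPairingUnit (𝟙 (𝟙_ C)) =
      rightMate (rightPairing (𝟙_ C)) exactPairingUnit (𝟙 (𝟙_ C))

variable [PivotalCategory C]

/-- The dual object `X^*`. -/
def dual (X : C) : C := PivotalCategory.dual X

/-- The left evaluation `X^* ⊗ X ⟶ 𝟙`. -/
def lev (X : C) : dual X ⊗ X ⟶ 𝟙_ C :=
  (PivotalCategory.leftPairing X).evaluation'

/-- The left coevaluation `𝟙 ⟶ X ⊗ X^*`. -/
def lcoev (X : C) : 𝟙_ C ⟶ X ⊗ dual X :=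
  (PivotalCategory.leftPairing X).coevaluation'

/-- The right evaluation `X ⊗ X^* ⟶ 𝟙`. -/
def rev (X : C) : X ⊗ dual X ⟶ 𝟙_ C :=
  (PivotalCategory.rightPairing X).evaluation'

/-- The right coevaluation `𝟙 ⟶ X^* ⊗ X`. -/
def rcoev (X : C) : 𝟙_ C ⟶ dual X ⊗ X :=
  (PivotalCategory.rightPairing X).coevaluation'

/-- The left trace of an endomorphism. -/
def leftTrace {X : C} (f : X ⟶ X) : 𝟙_ C ⟶ 𝟙_ C := rcoev X ≫ dual X ◁ f ≫ lev X

/-- The right trace of an endomorphism. -/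
def rightTrace {X : C} (f : X ⟶ X) : 𝟙_ C ⟶ 𝟙_ C := lcoev X ≫ f ▷ dual X ≫ rev X

lemma lcoev_lev (X : C) : lcoev X ▷ X ⊗≫ X ◁ lev X = ⊗𝟙.hom :=
  @ExactPairing.evaluation_coevaluation'' C _ _ X (dual X) (PivotalCategory.leftPairing X)

lemma lev_lcoev (X : C) : dual X ◁ lcoev X ⊗≫ lev X ▷ dual X = ⊗𝟙.hom :=
  @ExactPairing.coevaluation_evaluation'' C _ _ X (dual X) (PivotalCategory.leftPairing X)

lemma rcoev_rev (X : C) : rcoev X ▷ dual X ⊗≫ dual X ◁ rev X = ⊗𝟙.hom :=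
  @ExactPairing.evaluation_coevaluation'' C _ _ (dual X) X (PivotalCategory.rightPairing X)

lemma rev_rcoev (X : C) : X ◁ rcoev X ⊗≫ rev X ▷ X = ⊗𝟙.hom :=
  @ExactPairing.coevaluation_evaluation'' C _ _ (dual X) X (PivotalCategory.rightPairing X)

end Pivotal

section Fusion

variable (k : Type w) [CommRing k]
variable {C : Type u} [Category.{v} C] [Preadditive C] [Linear k C]

/-- An object `X` is scalar if `k → End X`, `a ↦ a • 𝟙 X` is bijective. -/
def IsScalar (X : C) : Prop := Function.Bijective (fun a : k => a • 𝟙 X)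

variable (C) in
/-- The conditions that make a `k`-additive monoidal category a fusion category over the commutative
ring `k`. (That `C` has finite direct sums and that composition and tensor product of morphisms are
`k`-bilinear is expressed by Mathlib's classes.) -/
class IsFusionCategory [MonoidalCategory C] [HasFiniteBiproducts C] [MonoidalPreadditive C]
    [MonoidalLinear k C] : Prop where
  exists_left_dual (X : C) : ∃ X' : C, Nonempty (ExactPairing X X')
  exists_right_dual (X : C) : ∃ X' : C, Nonempty (ExactPairing X' X)
  exists_iso_biproduct (X : C) :
    ∃ (n : ℕ) (S : Fin n → C), (∀ a, IsScalar k (S a)) ∧ Nonempty (X ≅ ⨁ S)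
  hom_eq_zero {i j : C} (hi : IsScalar k i) (hj : IsScalar k j) (hij : IsEmpty (i ≅ j))
    (f : i ⟶ j) : f = 0
  finite_scalar :
    {c : Quotient (isIsomorphicSetoid C) | ∃ i : C, IsScalar k i ∧ c = Quotient.mk _ i}.Finite
  scalar_unit : IsScalar k (𝟙_ C)

/-- A representative set of scalar objects: it consists of scalar objects, contains the unit object,
and every scalar object is isomorphic to exactly one of its elements. (In a fusion category such a
set is automatically finite.) -/
structure IsRepresentativeSet [MonoidalCategory C] (I : Finset C) : Prop where
  scalar : ∀ i ∈ I, IsScalar k i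
  unit_mem : 𝟙_ C ∈ I
  existsUnique_iso (X : C) : IsScalar k X → ∃! i, i ∈ I ∧ Nonempty (X ≅ i)

end Fusion

section Dimension

variable (k : Type w) [CommRing k]
variable {C : Type u} [Category.{v} C] [Preadditive C] [Linear k C] [MonoidalCategory C]
  [HasFiniteBiproducts C] [MonoidalPreadditive C] [MonoidalLinear k C] [IsFusionCategory k C]

/-- The canonical identification of `End 𝟙` with `k`. -/
noncomputable def unitCoeff : (𝟙_ C ⟶ 𝟙_ C) ≃ k :=
  (Equiv.ofBijective _ (IsFusionCategory.scalar_unit (k := k) (C := C))).symm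

variable [PivotalCategory C]

/-- The left dimension of an object, an element of `k`. -/
noncomputable def leftDim (X : C) : k := unitCoeff k (leftTrace (𝟙 X))

/-- The right dimension of an object, an element of `k`. -/
noncomputable def rightDim (X : C) : k := unitCoeff k (rightTrace (𝟙 X))

/-- The dimension of a pivotal fusion category with representative set `I` of scalar objects. -/
noncomputable def categoryDim (I : Finset C) : k := ∑ i ∈ I, leftDim k i * rightDim k i

end Dimension

section Partition

variable {C : Type u} [Category.{v} C] [Preadditive C]

/-- An explicit decomposition of `Y` as a direct sum of objects in `I`. The members of the
family with label `i` form an `i`-decomposition of `Y`. -/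
structure ScalarPartition (I : Finset C) (Y : C) where
  /-- the number of summands -/
  n : ℕ
  /-- the summands -/
  label : Fin n → I
  /-- the projections -/
  p (a : Fin n) : Y ⟶ (label a : C)
  /-- the inclusions -/
  q (a : Fin n) : (label a : C) ⟶ Y
  q_p_self (a : Fin n) : q a ≫ p a = 𝟙 _
  q_p_ne {a b : Fin n} (h : a ≠ b) : q a ≫ p b = 0
  total : ∑ a, p a ≫ q a = 𝟙 Y

variable (k : Type w) [CommRing k] [Linear k C] [MonoidalCategory C]
  [HasFiniteBiproducts C] [MonoidalPreadditive C] [MonoidalLinear k C]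

lemma nonempty_scalarPartition [IsFusionCategory k C] {I : Finset C}
    (hI : IsRepresentativeSet k I) (Y : C) : Nonempty (ScalarPartition I Y) := by
  obtain ⟨n, S, hS, ⟨e⟩⟩ := IsFusionCategory.exists_iso_biproduct (k := k) Y
  choose l hl _ using fun a => hI.existsUnique_iso (S a) (hS a)
  have e' : ∀ a, S a ≅ l a := fun a => (hl a).2.some
  refine ⟨{ n := n, label := fun a => ⟨l a, (hl a).1⟩
            p := fun a => e.hom ≫ biproduct.π S a ≫ (e' a).hom
            q := fun a => (e' a).inv ≫ biproduct.ι S a ≫ e.inv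
            q_p_self := fun a => by simp
            q_p_ne := fun {a b} h => by simp [biproduct.ι_π_ne_assoc S h]
            total := ?_ }⟩
  have : ∀ a, (e.hom ≫ biproduct.π S a ≫ (e' a).hom) ≫ (e' a).inv ≫ biproduct.ι S a ≫ e.inv =
      e.hom ≫ (biproduct.π S a ≫ biproduct.ι S a) ≫ e.inv := fun a => by simp
  simp only [this, ← Preadditive.comp_sum, ← Preadditive.sum_comp, biproduct.total]
  simp

/-- A chosen decomposition of `Y` into objects of `I`; nothing below depends on the choice. -/
noncomputable def partition [IsFusionCategory k C] {I : Finset C}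
    (hI : IsRepresentativeSet k I) (Y : C) : ScalarPartition I Y :=
  (nonempty_scalarPartition k hI Y).some

end Partition

section Free

variable {C : Type u} [Category.{v} C] [MonoidalCategory C] [PivotalCategory C]

/-- The morphism `i^* ⟶ Y ⊗ j^*` obtained from `q : j ⟶ i ⊗ Y` by duality, that is,
`(ev_i ⊗ id) (id ⊗ q ⊗ id) (id ⊗ coev_j)`. -/
def bend {i j Y : C} (q : j ⟶ i ⊗ Y) : dual i ⟶ Y ⊗ dual j :=
  (ρ_ (dual i)).inv ≫ dual i ◁ lcoev j ≫ dual i ◁ q ▷ dual j ≫ dual i ◁ (α_ i Y (dual j)).hom ≫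
    (α_ (dual i) i (Y ⊗ dual j)).inv ≫ lev i ▷ (Y ⊗ dual j) ≫ (λ_ (Y ⊗ dual j)).hom

/-- For `q : j ⟶ i ⊗ Y'` and `p : i ⊗ Y ⟶ j`, the morphism
`bend q ⊗ id_X ⊗ p : i^* ⊗ X ⊗ i ⊗ Y ⟶ Y' ⊗ j^* ⊗ X ⊗ j`. -/
def bendMap (X : C) {i j Y Y' : C} (q : j ⟶ i ⊗ Y') (p : i ⊗ Y ⟶ j) :
    (dual i ⊗ (X ⊗ i)) ⊗ Y ⟶ Y' ⊗ (dual j ⊗ (X ⊗ j)) :=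
  (α_ (dual i) (X ⊗ i) Y).hom ≫ dual i ◁ (α_ X i Y).hom ≫ dual i ◁ X ◁ p ≫
    bend q ▷ (X ⊗ j) ≫ (α_ Y' (dual j) (X ⊗ j)).hom

variable [Preadditive C] [HasFiniteBiproducts C]

/-- The object `Z(X) = ⨁_{i ∈ I} i^* ⊗ X ⊗ i`. -/
noncomputable def freeObj (I : Finset C) (X : C) : C :=
  ⨁ fun i : I => dual (i : C) ⊗ (X ⊗ (i : C))

/-- The inclusion of the summand of index `i` in `Z(X)`. -/
noncomputable def freeι {I : Finset C} (X : C) (i : I) :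
    dual (i : C) ⊗ (X ⊗ (i : C)) ⟶ freeObj I X :=
  biproduct.ι (fun i : I => dual (i : C) ⊗ (X ⊗ (i : C))) i

/-- The projection of `Z(X)` onto the summand of index `i`. -/
noncomputable def freeπ {I : Finset C} (X : C) (i : I) :
    freeObj I X ⟶ dual (i : C) ⊗ (X ⊗ (i : C)) :=
  biproduct.π (fun i : I => dual (i : C) ⊗ (X ⊗ (i : C))) i

lemma freeι_freeπ_self {I : Finset C} (X : C) (i : I) : freeι X i ≫ freeπ X i = 𝟙 _ :=
  biproduct.ι_π_self _ i

lemma freeι_freeπ_ne {I : Finset C} (X : C) {i j : I} (h : i ≠ j) :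
    freeι X i ≫ freeπ X j = 0 :=
  biproduct.ι_π_ne _ h

lemma free_total {I : Finset C} (X : C) : ∑ i : I, freeπ X i ≫ freeι X i = 𝟙 (freeObj I X) := by
  classical
  refine biproduct.hom_ext' _ _ fun i => ?_
  change freeι X i ≫ _ = freeι X i ≫ _
  rw [Preadditive.comp_sum, Finset.sum_eq_single i]
  · rw [← Category.assoc, freeι_freeπ_self, Category.id_comp, Category.comp_id]
  · intro j _ hj
    rw [← Category.assoc, freeι_freeπ_ne X hj.symm, zero_comp]
  · simp

variable (k : Type w) [CommRing k] [Linear k C] [MonoidalPreadditive C] [MonoidalLinear k C]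
  [IsFusionCategory k C]

/-- The half braiding `ς_{X,Y} : Z(X) ⊗ Y ⟶ Y ⊗ Z(X)`. Its component from the summand `i` to the
summand `j` is `∑_a bend q_a ⊗ id_X ⊗ p_a`, where `(p_a : i ⊗ Y ⟶ j, q_a : j ⟶ i ⊗ Y)_a` is
a `j`-decomposition of `i ⊗ Y`. -/
noncomputable def freeBraid {I : Finset C} (hI : IsRepresentativeSet k I) (X Y : C) :
    freeObj I X ⊗ Y ⟶ Y ⊗ freeObj I X :=
  ∑ i : I, ∑ a : Fin (partition k hI ((i : C) ⊗ Y)).n,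
    freeπ X i ▷ Y ≫
      bendMap X ((partition k hI ((i : C) ⊗ Y)).q a) ((partition k hI ((i : C) ⊗ Y)).p a) ≫
        Y ◁ freeι X ((partition k hI ((i : C) ⊗ Y)).label a)

end Free


section FreeLemmas

variable {C : Type u} [Category.{v} C] [MonoidalCategory C] [PivotalCategory C]

lemma bend_comp_whiskerLeft {i j Y Y' : C} (q : j ⟶ i ⊗ Y) (f : Y ⟶ Y') :
    bend (q ≫ i ◁ f) = bend q ≫ f ▷ dual j := by
  dsimp only [bend]
  calc
    _ = 𝟙 _ ⊗≫ dual i ◁ lcoev j ⊗≫ dual i ◁ q ▷ dual j ⊗≫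
        ((dual i ⊗ i) ◁ (f ▷ dual j) ≫ lev i ▷ (Y' ⊗ dual j)) ⊗≫ 𝟙 _ := by monoidal
    _ = 𝟙 _ ⊗≫ dual i ◁ lcoev j ⊗≫ dual i ◁ q ▷ dual j ⊗≫
        (lev i ▷ (Y ⊗ dual j) ≫ 𝟙_ C ◁ (f ▷ dual j)) ⊗≫ 𝟙 _ := by rw [whisker_exchange]
    _ = _ := by monoidal

lemma lcoev_bend {j l Y : C} (h : l ⟶ j ⊗ Y) :
    lcoev j ≫ j ◁ bend h = lcoev l ≫ h ▷ dual l ≫ (α_ j Y (dual l)).hom := by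
  dsimp only [bend]
  calc
    _ = 𝟙 _ ⊗≫ (lcoev j ▷ 𝟙_ C ≫ (j ⊗ dual j) ◁ (lcoev l ≫ h ▷ dual l)) ⊗≫
          j ◁ lev j ▷ (Y ⊗ dual l) ⊗≫ 𝟙 _ := by monoidal
    _ = 𝟙 _ ⊗≫ (lcoev l ≫ h ▷ dual l) ⊗≫ (lcoev j ▷ j ⊗≫ j ◁ lev j) ▷ (Y ⊗ dual l) ⊗≫ 𝟙 _ := by
      rw [← whisker_exchange]; monoidal
    _ = _ := by rw [lcoev_lev]; monoidal

lemma bend_tensor {i j l Y Y' : C} (h : j ⟶ i ⊗ Y) (h' : l ⟶ j ⊗ Y') :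
    bend (h' ≫ h ▷ Y' ≫ (α_ i Y Y').hom) =
      bend h ≫ Y ◁ bend h' ≫ (α_ Y Y' (dual l)).inv := by
  symm
  rw [bend]
  calc
    _ = 𝟙 _ ⊗≫ dual i ◁ lcoev j ⊗≫ dual i ◁ h ▷ dual j ⊗≫
          (lev i ▷ (Y ⊗ dual j) ≫ 𝟙_ C ◁ (Y ◁ bend h')) ⊗≫ 𝟙 _ := by monoidal
    _ = 𝟙 _ ⊗≫ dual i ◁ lcoev j ⊗≫ dual i ◁ (h ▷ dual j ≫ (i ⊗ Y) ◁ bend h') ⊗≫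
          lev i ▷ (Y ⊗ Y' ⊗ dual l) ⊗≫ 𝟙 _ := by
      rw [← whisker_exchange]; monoidal
    _ = 𝟙 _ ⊗≫ dual i ◁ (lcoev j ≫ j ◁ bend h') ⊗≫ dual i ◁ h ▷ (Y' ⊗ dual l) ⊗≫
          lev i ▷ (Y ⊗ Y' ⊗ dual l) ⊗≫ 𝟙 _ := by
      rw [← whisker_exchange]; monoidal
    _ = _ := by rw [lcoev_bend, bend]; monoidal

lemma bend_unit (i : C) : bend (ρ_ i).inv = (λ_ (dual i)).inv := by
  dsimp only [bend]
  calc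
    _ = 𝟙 _ ⊗≫ (dual i ◁ lcoev i ⊗≫ lev i ▷ dual i) ⊗≫ 𝟙 _ := by monoidal
    _ = _ := by rw [lev_lcoev]; monoidal

lemma bendMap_naturality_left (X : C) {i j Y Y' Y'' : C} (q : j ⟶ i ⊗ Y') (p : i ⊗ Y ⟶ j)
    (f : Y' ⟶ Y'') : bendMap X (q ≫ i ◁ f) p = bendMap X q p ≫ f ▷ _ := by
  simp [bendMap, bend_comp_whiskerLeft]

lemma bendMap_naturality_right (X : C) {i j Y Y' Y'' : C} (q : j ⟶ i ⊗ Y') (p : i ⊗ Y ⟶ j)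
    (f : Y'' ⟶ Y) : bendMap X q (i ◁ f ≫ p) = _ ◁ f ≫ bendMap X q p := by
  simp [bendMap]

lemma bendMap_tensor (X : C) {i j l Y Y' : C} (q : j ⟶ i ⊗ Y) (p : i ⊗ Y ⟶ j)
    (q' : l ⟶ j ⊗ Y') (p' : j ⊗ Y' ⟶ l) :
    bendMap X (q' ≫ q ▷ Y' ≫ (α_ i Y Y').hom) ((α_ i Y Y').inv ≫ p ▷ Y' ≫ p') =
      (α_ _ _ _).inv ≫ bendMap X q p ▷ Y' ≫ (α_ _ _ _).hom ≫ Y ◁ bendMap X q' p' ≫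
        (α_ _ _ _).inv := by
  symm
  simp only [bendMap, bend_tensor]
  calc
    _ = 𝟙 _ ⊗≫ dual i ◁ X ◁ p ▷ Y' ⊗≫
        (bend q ▷ (X ⊗ j ⊗ Y') ≫ (Y ⊗ dual j) ◁ (X ◁ p')) ⊗≫
        Y ◁ bend q' ▷ (X ⊗ l) ⊗≫ 𝟙 _ := by monoidal
    _ = _ := by rw [← whisker_exchange]; monoidal

/-- In a pivotal category, a family `A ⊗ Y ⟶ Y ⊗ A` that is natural and multiplicative in `Y`
and canonical for the unit object is invertible; this is its inverse. -/
def braidInv {A : C} (s : ∀ Y, A ⊗ Y ⟶ Y ⊗ A) (Y : C) : Y ⊗ A ⟶ A ⊗ Y :=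
  𝟙 _ ⊗≫ (Y ⊗ A) ◁ rcoev Y ⊗≫ Y ◁ s (dual Y) ▷ Y ⊗≫ rev Y ▷ (A ⊗ Y) ⊗≫ 𝟙 _

lemma braid_comp_inv {A : C} (s : ∀ Y, A ⊗ Y ⟶ Y ⊗ A)
    (hnat : ∀ {Y Y' : C} (f : Y ⟶ Y'), A ◁ f ≫ s Y' = s Y ≫ f ▷ A)
    (hten : ∀ Y Y', s (Y ⊗ Y') = (α_ _ _ _).inv ≫ s Y ▷ Y' ≫ (α_ _ _ _).hom ≫ Y ◁ s Y' ≫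
      (α_ _ _ _).inv)
    (hunit : s (𝟙_ C) = (ρ_ A).hom ≫ (λ_ A).inv) (Y : C) : s Y ≫ braidInv s Y = 𝟙 _ := by
  have h1 := hnat (rev Y)
  rw [hten, hunit] at h1
  dsimp only [braidInv]
  calc
    _ = 𝟙 _ ⊗≫ (s Y ▷ 𝟙_ C ≫ (Y ⊗ A) ◁ rcoev Y) ⊗≫ Y ◁ s (dual Y) ▷ Y ⊗≫
        rev Y ▷ (A ⊗ Y) ⊗≫ 𝟙 _ := by monoidal
    _ = 𝟙 _ ⊗≫ (A ⊗ Y) ◁ rcoev Y ⊗≫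
        (((α_ _ _ _).inv ≫ s Y ▷ dual Y ≫ (α_ _ _ _).hom ≫ Y ◁ s (dual Y) ≫ (α_ _ _ _).inv) ≫
          rev Y ▷ A) ▷ Y ⊗≫ 𝟙 _ := by
      rw [← whisker_exchange]; monoidal
    _ = 𝟙 _ ⊗≫ A ◁ (Y ◁ rcoev Y ⊗≫ rev Y ▷ Y) ⊗≫ 𝟙 _ := by
      rw [← h1]; monoidal
    _ = _ := by rw [rev_rcoev]; monoidal

lemma inv_comp_braid {A : C} (s : ∀ Y, A ⊗ Y ⟶ Y ⊗ A)
    (hnat : ∀ {Y Y' : C} (f : Y ⟶ Y'), A ◁ f ≫ s Y' = s Y ≫ f ▷ A)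
    (hten : ∀ Y Y', s (Y ⊗ Y') = (α_ _ _ _).inv ≫ s Y ▷ Y' ≫ (α_ _ _ _).hom ≫ Y ◁ s Y' ≫
      (α_ _ _ _).inv)
    (hunit : s (𝟙_ C) = (ρ_ A).hom ≫ (λ_ A).inv) (Y : C) : braidInv s Y ≫ s Y = 𝟙 _ := by
  have h1 := hnat (rcoev Y)
  rw [hten, hunit] at h1
  dsimp only [braidInv]
  calc
    _ = 𝟙 _ ⊗≫ (Y ⊗ A) ◁ rcoev Y ⊗≫ Y ◁ s (dual Y) ▷ Y ⊗≫
        (rev Y ▷ (A ⊗ Y) ≫ 𝟙_ C ◁ s Y) ⊗≫ 𝟙 _ := by monoidal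
    _ = 𝟙 _ ⊗≫ Y ◁ (A ◁ rcoev Y ≫ ((α_ _ _ _).inv ≫ s (dual Y) ▷ Y ≫ (α_ _ _ _).hom ≫
          dual Y ◁ s Y ≫ (α_ _ _ _).inv)) ⊗≫ rev Y ▷ (Y ⊗ A) ⊗≫ 𝟙 _ := by
      rw [← whisker_exchange]; monoidal
    _ = 𝟙 _ ⊗≫ (Y ◁ rcoev Y ⊗≫ rev Y ▷ Y) ▷ A ⊗≫ 𝟙 _ := by
      rw [h1]; monoidal
    _ = _ := by rw [rev_rcoev]; monoidal

end FreeLemmas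

section FreeCenter

variable {C : Type u} [Category.{v} C] [MonoidalCategory C] [PivotalCategory C]
  [Preadditive C] [MonoidalPreadditive C]

lemma bend_sum {i j Y : C} {A : Type*} (s : Finset A) (q : A → (j ⟶ i ⊗ Y)) :
    bend (∑ a ∈ s, q a) = ∑ a ∈ s, bend (q a) := by
  simp only [bend, sum_whiskerRight, whiskerLeft_sum, Preadditive.comp_sum,
    Preadditive.sum_comp]

lemma bendMap_sum_left (X : C) {i j Y Y' : C} {A : Type*} (s : Finset A)
    (q : A → (j ⟶ i ⊗ Y')) (p : i ⊗ Y ⟶ j) :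
    bendMap X (∑ a ∈ s, q a) p = ∑ a ∈ s, bendMap X (q a) p := by
  simp only [bendMap, bend_sum, sum_whiskerRight, Preadditive.comp_sum, Preadditive.sum_comp]

lemma bendMap_sum_right (X : C) {i j Y Y' : C} {A : Type*} (s : Finset A)
    (q : j ⟶ i ⊗ Y') (p : A → (i ⊗ Y ⟶ j)) :
    bendMap X q (∑ a ∈ s, p a) = ∑ a ∈ s, bendMap X q (p a) := by
  simp only [bendMap, whiskerLeft_sum, Preadditive.comp_sum, Preadditive.sum_comp]

lemma bendMap_zero_left (X : C) {i j Y Y' : C} (p : i ⊗ Y ⟶ j) :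
    bendMap X (0 : j ⟶ i ⊗ Y') p = 0 := by
  simp [bendMap, bend]

lemma bendMap_zero_right (X : C) {i j Y Y' : C} (q : j ⟶ i ⊗ Y') :
    bendMap X q (0 : i ⊗ Y ⟶ j) = 0 := by
  simp [bendMap]

lemma bendMap_smul_left (k : Type w) [CommRing k] [Linear k C] [MonoidalLinear k C]
    (X : C) {i j Y Y' : C} (c : k) (q : j ⟶ i ⊗ Y') (p : i ⊗ Y ⟶ j) :
    bendMap X (c • q) p = c • bendMap X q p := by
  simp [bendMap, bend]

lemma bendMap_smul_right (k : Type w) [CommRing k] [Linear k C] [MonoidalLinear k C]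
    (X : C) {i j Y Y' : C} (c : k) (q : j ⟶ i ⊗ Y') (p : i ⊗ Y ⟶ j) :
    bendMap X q (c • p) = c • bendMap X q p := by
  simp [bendMap]

variable [HasFiniteBiproducts C]

lemma free_hom_ext {I : Finset C} {X Y Z : C} {f g : freeObj I X ⊗ Y ⟶ Z}
    (h : ∀ i : I, freeι X i ▷ Y ≫ f = freeι X i ▷ Y ≫ g) : f = g := by
  have h1 : 𝟙 (freeObj I X ⊗ Y) = ∑ i : I, freeπ X i ▷ Y ≫ freeι X i ▷ Y := by
    simp only [← comp_whiskerRight, ← sum_whiskerRight, free_total, id_whiskerRight]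
  rw [← Category.id_comp f, ← Category.id_comp g, h1, Preadditive.sum_comp, Preadditive.sum_comp]
  exact Finset.sum_congr rfl fun i _ => by rw [Category.assoc, Category.assoc, h i]

variable (k : Type w) [CommRing k] [Linear k C] [MonoidalLinear k C]
  [IsFusionCategory k C] {I : Finset C} (hI : IsRepresentativeSet k I)

lemma freeι_freeBraid (X Y : C) (i : I) :
    freeι X i ▷ Y ≫ freeBraid k hI X Y = ∑ a : Fin (partition k hI ((i : C) ⊗ Y)).n,
      bendMap X ((partition k hI ((i : C) ⊗ Y)).q a) ((partition k hI ((i : C) ⊗ Y)).p a) ≫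
        Y ◁ freeι X ((partition k hI ((i : C) ⊗ Y)).label a) := by
  classical
  rw [freeBraid, Preadditive.comp_sum, Finset.sum_eq_single i]
  · rw [Preadditive.comp_sum]
    refine Finset.sum_congr rfl fun a _ => ?_
    rw [← comp_whiskerRight_assoc, freeι_freeπ_self, id_whiskerRight,
      Category.id_comp]
  · intro j _ hj
    rw [Preadditive.comp_sum]
    refine Finset.sum_eq_zero fun a _ => ?_
    rw [← comp_whiskerRight_assoc, freeι_freeπ_ne X hj.symm,
      MonoidalPreadditive.zero_whiskerRight, zero_comp]
  · simp

lemma bendMap_dinat (hI : IsRepresentativeSet k I) (X : C) {i Y Y' : C} {j j' : I}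
    (g : (j : C) ⟶ j') (q : (j' : C) ⟶ i ⊗ Y') (p : i ⊗ Y ⟶ j) :
    bendMap X (g ≫ q) p ≫ Y' ◁ freeι X j = bendMap X q (p ≫ g) ≫ Y' ◁ freeι X j' := by
  by_cases h : j = j'
  · subst h
    obtain ⟨c, rfl⟩ := (hI.scalar _ j.2).2 g
    simp [bendMap_smul_left, bendMap_smul_right]
  · have hg : g = 0 := by
      refine IsFusionCategory.hom_eq_zero (hI.scalar _ j.2) (hI.scalar _ j'.2) ⟨fun e => h ?_⟩ g
      exact Subtype.ext ((hI.existsUnique_iso (j : C) (hI.scalar _ j.2)).unique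
        ⟨j.2, ⟨Iso.refl _⟩⟩ ⟨j'.2, ⟨e⟩⟩)
    rw [hg, zero_comp, comp_zero, bendMap_zero_left, bendMap_zero_right, zero_comp, zero_comp]

lemma sum_bendMap_change (hI : IsRepresentativeSet k I) (X : C) {i Y Y' : C}
    (f : i ⊗ Y ⟶ i ⊗ Y') {A B : Type*} [Fintype A] [Fintype B] (l : A → I) (m : B → I)
    (p : ∀ a, i ⊗ Y ⟶ (l a : C)) (q : ∀ a, (l a : C) ⟶ i ⊗ Y) (hpq : ∑ a, p a ≫ q a = 𝟙 _)
    (p' : ∀ b, i ⊗ Y' ⟶ (m b : C)) (q' : ∀ b, (m b : C) ⟶ i ⊗ Y')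
    (hpq' : ∑ b, p' b ≫ q' b = 𝟙 _) :
    ∑ a, bendMap X (q a ≫ f) (p a) ≫ Y' ◁ freeι X (l a) =
      ∑ b, bendMap X (q' b) (f ≫ p' b) ≫ Y' ◁ freeι X (m b) := by
  have h1 : ∀ a, q a ≫ f = ∑ b, (q a ≫ f ≫ p' b) ≫ q' b := fun a => by
    simp only [Category.assoc, ← Preadditive.comp_sum, hpq', Category.comp_id]
  have h2 : ∀ b, f ≫ p' b = ∑ a, p a ≫ q a ≫ f ≫ p' b := fun b => by
    simp only [← Category.assoc, ← Preadditive.sum_comp, hpq, Category.id_comp]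
  calc
    _ = ∑ a, ∑ b, bendMap X ((q a ≫ f ≫ p' b) ≫ q' b) (p a) ≫ Y' ◁ freeι X (l a) := by
      refine Finset.sum_congr rfl fun a _ => ?_
      rw [h1, bendMap_sum_left, Preadditive.sum_comp]
    _ = ∑ a, ∑ b, bendMap X (q' b) (p a ≫ q a ≫ f ≫ p' b) ≫ Y' ◁ freeι X (m b) :=
      Finset.sum_congr rfl fun a _ => Finset.sum_congr rfl fun b _ =>
        bendMap_dinat k hI X _ _ _
    _ = _ := by
      rw [Finset.sum_comm]
      refine Finset.sum_congr rfl fun b _ => ?_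
      conv_rhs => rw [h2 b, bendMap_sum_right, Preadditive.sum_comp]

lemma freeBraid_naturality (X : C) {Y Y' : C} (f : Y ⟶ Y') :
    freeObj I X ◁ f ≫ freeBraid k hI X Y' = freeBraid k hI X Y ≫ f ▷ freeObj I X := by
  refine free_hom_ext fun i => ?_
  rw [← whisker_exchange_assoc, freeι_freeBraid, reassoc_of% (freeι_freeBraid k hI X Y i),
    Preadditive.comp_sum, Preadditive.sum_comp]
  have := sum_bendMap_change k hI X ((i : C) ◁ f) _ _ _ _
    (partition k hI ((i : C) ⊗ Y)).total _ _ (partition k hI ((i : C) ⊗ Y')).total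
  simp only [bendMap_naturality_left, bendMap_naturality_right, Category.assoc] at this
  simp only [Category.assoc, ← this, whisker_exchange]

lemma freeBraid_unit (X : C) :
    freeBraid k hI X (𝟙_ C) = (ρ_ (freeObj I X)).hom ≫ (λ_ (freeObj I X)).inv := by
  refine free_hom_ext fun i => ?_
  have := sum_bendMap_change k hI X (𝟙 ((i : C) ⊗ 𝟙_ C)) _ (fun _ : Unit => i) _ _
    (partition k hI ((i : C) ⊗ 𝟙_ C)).total (fun _ => (ρ_ (i : C)).hom) (fun _ => (ρ_ (i : C)).inv)
    (by simp)
  simp only [Category.id_comp, Category.comp_id] at this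
  rw [freeι_freeBraid, this]
  simp [bendMap, bend_unit]

lemma freeBraid_tensor (X Y Y' : C) :
    freeBraid k hI X (Y ⊗ Y') = (α_ _ _ _).inv ≫ freeBraid k hI X Y ▷ Y' ≫ (α_ _ _ _).hom ≫
      Y ◁ freeBraid k hI X Y' ≫ (α_ _ _ _).inv := by
  refine free_hom_ext fun i => ?_
  let P := partition k hI ((i : C) ⊗ Y)
  let Q : ∀ a, ScalarPartition I ((P.label a : C) ⊗ Y') := fun a => partition k hI _
  have htot : ∑ x : (Σ a : Fin P.n, Fin (Q a).n),
      ((α_ (i : C) Y Y').inv ≫ P.p x.1 ▷ Y' ≫ (Q x.1).p x.2) ≫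
        ((Q x.1).q x.2 ≫ P.q x.1 ▷ Y' ≫ (α_ (i : C) Y Y').hom) = 𝟙 _ := by
    rw [Fintype.sum_sigma]
    have : ∀ a, ∑ b, ((α_ (i : C) Y Y').inv ≫ P.p a ▷ Y' ≫ (Q a).p b) ≫
        ((Q a).q b ≫ P.q a ▷ Y' ≫ (α_ (i : C) Y Y').hom) =
        (α_ (i : C) Y Y').inv ≫ (P.p a ≫ P.q a) ▷ Y' ≫ (α_ (i : C) Y Y').hom := fun a => by
      have h := (Q a).total
      have h' : ∀ b, ((α_ (i : C) Y Y').inv ≫ P.p a ▷ Y' ≫ (Q a).p b) ≫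
          ((Q a).q b ≫ P.q a ▷ Y' ≫ (α_ (i : C) Y Y').hom) =
          (α_ (i : C) Y Y').inv ≫ P.p a ▷ Y' ≫ ((Q a).p b ≫ (Q a).q b) ≫
          P.q a ▷ Y' ≫ (α_ (i : C) Y Y').hom := fun b => by simp
      simp only [h', ← Preadditive.comp_sum, ← Preadditive.sum_comp, h]
      simp
    simp only [this, ← Preadditive.comp_sum, ← Preadditive.sum_comp, ← sum_whiskerRight, P.total]
    simp
  have := sum_bendMap_change k hI X (𝟙 ((i : C) ⊗ (Y ⊗ Y'))) _
    (fun x : (Σ a : Fin P.n, Fin (Q a).n) => (Q x.1).label x.2) _ _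
    (partition k hI ((i : C) ⊗ (Y ⊗ Y'))).total
    (fun x => (α_ (i : C) Y Y').inv ≫ P.p x.1 ▷ Y' ≫ (Q x.1).p x.2)
    (fun x => (Q x.1).q x.2 ≫ P.q x.1 ▷ Y' ≫ (α_ (i : C) Y Y').hom) htot
  simp only [Category.id_comp, Category.comp_id] at this
  rw [freeι_freeBraid, this, Fintype.sum_sigma]
  simp only [bendMap_tensor]
  have h3 : freeι X i ▷ (Y ⊗ Y') ≫ (α_ _ _ _).inv ≫ freeBraid k hI X Y ▷ Y' =
      (α_ _ _ _).inv ≫ (freeι X i ▷ Y ≫ freeBraid k hI X Y) ▷ Y' := by simp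
  rw [reassoc_of% h3, freeι_freeBraid, sum_whiskerRight, Preadditive.sum_comp, Preadditive.comp_sum]
  refine Finset.sum_congr rfl fun a _ => ?_
  have h4 : ∀ {U : C} (g : U ⟶ Y ⊗ (dual (P.label a : C) ⊗ (X ⊗ (P.label a : C)))),
      (g ≫ Y ◁ freeι X (P.label a)) ▷ Y' ≫ (α_ _ _ _).hom ≫ Y ◁ freeBraid k hI X Y' =
      g ▷ Y' ≫ (α_ _ _ _).hom ≫ Y ◁ (freeι X (P.label a) ▷ Y' ≫ freeBraid k hI X Y') :=
    fun g => by simp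
  rw [reassoc_of% h4, freeι_freeBraid, whiskerLeft_sum]
  simp only [Preadditive.sum_comp, Preadditive.comp_sum]
  refine Finset.sum_congr rfl fun b _ => ?_
  simp [P, Q]

/-- The free half braiding `F(X) = (Z(X), ς_X)`, an object of the center. -/
noncomputable def freeHalfBraiding (X : C) : Center C :=
  ⟨freeObj I X,
    { β := fun Y =>
        { hom := freeBraid k hI X Y
          inv := braidInv (freeBraid k hI X) Y
          hom_inv_id := braid_comp_inv _ (freeBraid_naturality k hI X) (freeBraid_tensor k hI X)
            (freeBraid_unit k hI X) Y
          inv_hom_id := inv_comp_braid _ (freeBraid_naturality k hI X) (freeBraid_tensor k hI X)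
            (freeBraid_unit k hI X) Y }
      monoidal := freeBraid_tensor k hI X
      naturality := freeBraid_naturality k hI X }⟩

end FreeCenter

end FusionCenter

/-! Everything rests on one identity. A decomposition `(p_a, q_a)` of `i ⊗ Y` rotates to morphisms
`cobend p_a : Y ⊗ j^* ⟶ i^*` and `bend q_a : i^* ⟶ Y ⊗ j^*`. Closing the `i`- or the `j`-strand
gives the same scalar, so rotation exchanges the coefficients of `bend q ≫ cobend p` and `q ≫ p` up
to the right dimensions of `i` and `j` (`smul_rightDim_eq`). Hence the rotated morphisms, weighted
by `dim_r(i)`, sum to `dim_r(j)` times the identity of `Y ⊗ j^*` (`sum_rightDim_smul_cobend_bend`).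
No dimension of an object is inverted.

Forward direction: a half braiding `(A, σ)` has a counit `F(A) ⟶ (A, σ)`, which braids `A` past `i`
and evaluates `i^* ⊗ i`. In the other direction, inserting `rcoev i` and braiding `A` past `i^*`
gives maps `A ⟶ i^* ⊗ A ⊗ i`. Weighted by `dim_r(i)`, they form a morphism of the center exactly
because of the identity above (`averaging_comm`). Naturality of `σ` at `lev i` makes the composite
`dim(C)` times the identity of `A` (`averaging_counit`), so dividing by `dim(C)` exhibits the
retract.

Converse: the unit object of the center is a retract of some `F(X)`, through `s` and `e`. Centrality
makes `e` come from a single `t : X ⟶ 𝟙`; applying `t` to the components of `s` leaves multiples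
`c_i` of `rcoev i`. Centrality of `s` forces `dim_r(i) c_𝟙 = dim_r(𝟙) c_i`, and `s ≫ e = 𝟙` reads `∑
c_i dim_l(i) = 1`. Together they give `dim(C) c_𝟙 = dim_r(𝟙)`, which is a unit. -/

namespace FusionCenter

/-! ### Duality calculus: bending strands by the left and the right duality. -/

section Zigzag

variable {C : Type u} [Category.{v} C] [MonoidalCategory C] [PivotalCategory C]

/-- The morphism `i^* ⟶ W` obtained from `r : 𝟙 ⟶ i ⊗ W` by duality. -/
def curl {i W : C} (r : 𝟙_ C ⟶ i ⊗ W) : dual i ⟶ W :=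
  𝟙 _ ⊗≫ dual i ◁ r ⊗≫ lev i ▷ W ⊗≫ 𝟙 _

lemma lcoev_curl {i W : C} (r : 𝟙_ C ⟶ i ⊗ W) : lcoev i ≫ i ◁ curl r = r := by
  dsimp only [curl]
  calc
    _ = 𝟙 _ ⊗≫ (lcoev i ▷ 𝟙_ C ≫ (i ⊗ dual i) ◁ r) ⊗≫ i ◁ lev i ▷ W ⊗≫ 𝟙 _ := by monoidal
    _ = 𝟙 _ ⊗≫ r ⊗≫ (lcoev i ▷ i ⊗≫ i ◁ lev i) ▷ W ⊗≫ 𝟙 _ := by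
      rw [← whisker_exchange]; monoidal
    _ = _ := by rw [lcoev_lev]; monoidal

lemma curl_lcoev {i W : C} (h : dual i ⟶ W) : curl (lcoev i ≫ i ◁ h) = h := by
  dsimp only [curl]
  calc
    _ = 𝟙 _ ⊗≫ dual i ◁ lcoev i ⊗≫ ((dual i ⊗ i) ◁ h ≫ lev i ▷ W) ⊗≫ 𝟙 _ := by monoidal
    _ = 𝟙 _ ⊗≫ (dual i ◁ lcoev i ⊗≫ lev i ▷ dual i) ⊗≫ h ⊗≫ 𝟙 _ := by
      rw [whisker_exchange]; monoidal
    _ = _ := by rw [lev_lcoev]; monoidal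

lemma lcoev_injective {i W : C} {h h' : dual i ⟶ W} (e : lcoev i ≫ i ◁ h = lcoev i ≫ i ◁ h') :
    h = h' := by
  rw [← curl_lcoev h, e, curl_lcoev]

lemma lcoev_whiskerRight_left_injective {i V W : C} {w w' : dual i ⊗ V ⟶ W}
    (e : lcoev i ▷ V ⊗≫ i ◁ w = lcoev i ▷ V ⊗≫ i ◁ w') : w = w' := by
  have key : ∀ w : dual i ⊗ V ⟶ W,
      𝟙 _ ⊗≫ dual i ◁ (lcoev i ▷ V ⊗≫ i ◁ w) ⊗≫ lev i ▷ W ⊗≫ 𝟙 _ = w := fun w => by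
    calc
      _ = 𝟙 _ ⊗≫ dual i ◁ lcoev i ▷ V ⊗≫ ((dual i ⊗ i) ◁ w ≫ lev i ▷ W) ⊗≫ 𝟙 _ := by monoidal
      _ = 𝟙 _ ⊗≫ (dual i ◁ lcoev i ⊗≫ lev i ▷ dual i) ▷ V ⊗≫ w ⊗≫ 𝟙 _ := by
        rw [whisker_exchange]; monoidal
      _ = _ := by rw [lev_lcoev]; monoidal
  rw [← key w, e, key]

/-- The morphism `j ⟶ i ⊗ Y` obtained from `g : i^* ⟶ Y ⊗ j^*` by duality. -/
def unbend {i j Y : C} (g : dual i ⟶ Y ⊗ dual j) : j ⟶ i ⊗ Y :=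
  𝟙 _ ⊗≫ (lcoev i ≫ i ◁ g) ▷ j ⊗≫ (i ⊗ Y) ◁ lev j ⊗≫ 𝟙 _

lemma unbend_bend {i j Y : C} (q : j ⟶ i ⊗ Y) : unbend (bend q) = q := by
  dsimp only [unbend]
  rw [lcoev_bend]
  calc
    _ = 𝟙 _ ⊗≫ lcoev j ▷ j ⊗≫ (q ▷ (dual j ⊗ j) ≫ (i ⊗ Y) ◁ lev j) ⊗≫ 𝟙 _ := by monoidal
    _ = 𝟙 _ ⊗≫ (lcoev j ▷ j ⊗≫ j ◁ lev j) ⊗≫ q ⊗≫ 𝟙 _ := by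
      rw [← whisker_exchange]; monoidal
    _ = _ := by rw [lcoev_lev]; monoidal

lemma bend_unbend {i j Y : C} (g : dual i ⟶ Y ⊗ dual j) : bend (unbend g) = g := by
  apply lcoev_injective
  rw [lcoev_bend]
  dsimp only [unbend]
  generalize lcoev i ≫ i ◁ g = r
  calc
    _ = 𝟙 _ ⊗≫ (𝟙_ C ◁ lcoev j ≫ r ▷ (j ⊗ dual j)) ⊗≫ (i ⊗ Y) ◁ lev j ▷ dual j ⊗≫ 𝟙 _ := by
      monoidal
    _ = 𝟙 _ ⊗≫ r ⊗≫ (i ⊗ Y) ◁ (dual j ◁ lcoev j ⊗≫ lev j ▷ dual j) ⊗≫ 𝟙 _ := by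
      rw [whisker_exchange]; monoidal
    _ = _ := by rw [lev_lcoev]; monoidal

/-- The morphism `Y ⊗ j^* ⟶ i^*` obtained from `p : i ⊗ Y ⟶ j` by duality, using the right
evaluation and coevaluation. -/
def cobend {i j Y : C} (p : i ⊗ Y ⟶ j) : Y ⊗ dual j ⟶ dual i :=
  𝟙 _ ⊗≫ rcoev i ▷ (Y ⊗ dual j) ⊗≫ dual i ◁ (p ▷ dual j ≫ rev j) ⊗≫ 𝟙 _

lemma cobend_rev {i j Y : C} (p : i ⊗ Y ⟶ j) :
    i ◁ cobend p ≫ rev i = (α_ i Y (dual j)).inv ≫ p ▷ dual j ≫ rev j := by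
  dsimp only [cobend]
  generalize h : p ▷ dual j ≫ rev j = f
  calc
    _ = 𝟙 _ ⊗≫ i ◁ rcoev i ▷ (Y ⊗ dual j) ⊗≫ ((i ⊗ dual i) ◁ f ≫ rev i ▷ 𝟙_ C) ⊗≫ 𝟙 _ := by
      monoidal
    _ = 𝟙 _ ⊗≫ (i ◁ rcoev i ⊗≫ rev i ▷ i) ▷ (Y ⊗ dual j) ⊗≫ f ⊗≫ 𝟙 _ := by
      rw [whisker_exchange]; monoidal
    _ = _ := by rw [rev_rcoev]; monoidal

/-- Two readings of one closed diagram: sliding `q` through `lcoev` and `p` through `rev` trades the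
loop on `i` for a loop on `j`. This is the source of all dimension factors. -/
lemma lcoev_bend_cobend_rev {i j Y : C} (q : j ⟶ i ⊗ Y) (p : i ⊗ Y ⟶ j) :
    lcoev i ≫ i ◁ (bend q ≫ cobend p) ≫ rev i = lcoev j ≫ (q ≫ p) ▷ dual j ≫ rev j := by
  rw [MonoidalCategory.whiskerLeft_comp, Category.assoc, cobend_rev, ← Category.assoc, lcoev_bend]
  simp

/-- The morphism `Y ⟶ Y ⊗ j^* ⊗ j` obtained from `q : j ⟶ i ⊗ Y` and `p : i ⊗ Y ⟶ j`. -/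
def rcoevBend {i j Y : C} (q : j ⟶ i ⊗ Y) (p : i ⊗ Y ⟶ j) : Y ⟶ (Y ⊗ dual j) ⊗ j :=
  𝟙 _ ⊗≫ rcoev i ▷ Y ⊗≫ dual i ◁ p ≫ bend q ▷ j

lemma rcoev_cobend {i j Y : C} (p : i ⊗ Y ⟶ j) :
    (𝟙 Y ⊗≫ Y ◁ rcoev j ⊗≫ cobend p ▷ j : Y ⟶ dual i ⊗ j) =
      𝟙 Y ⊗≫ rcoev i ▷ Y ⊗≫ dual i ◁ p := by
  dsimp only [cobend]
  calc
    _ = 𝟙 _ ⊗≫ (𝟙_ C ◁ (Y ◁ rcoev j) ≫ rcoev i ▷ (Y ⊗ dual j ⊗ j)) ⊗≫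
          dual i ◁ (p ▷ dual j ≫ rev j) ▷ j ⊗≫ 𝟙 _ := by monoidal
    _ = 𝟙 _ ⊗≫ rcoev i ▷ Y ⊗≫ dual i ◁ ((i ⊗ Y) ◁ rcoev j ≫ p ▷ (dual j ⊗ j)) ⊗≫
          dual i ◁ rev j ▷ j ⊗≫ 𝟙 _ := by
      rw [whisker_exchange]; monoidal
    _ = 𝟙 _ ⊗≫ rcoev i ▷ Y ⊗≫ dual i ◁ p ⊗≫ dual i ◁ (j ◁ rcoev j ⊗≫ rev j ▷ j) ⊗≫ 𝟙 _ := by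
      rw [whisker_exchange]; monoidal
    _ = _ := by rw [rev_rcoev]; monoidal

/-- Sliding `p` around `rcoev` isolates an endomorphism of `Y ⊗ j^*`, so that relations among the
`rcoevBend` become relations among the `cobend p ≫ bend q`. -/
lemma rcoevBend_eq {i j Y : C} (q : j ⟶ i ⊗ Y) (p : i ⊗ Y ⟶ j) :
    rcoevBend q p = 𝟙 _ ⊗≫ Y ◁ rcoev j ⊗≫ (cobend p ≫ bend q) ▷ j := by
  have := congrArg (· ≫ bend q ▷ j) (rcoev_cobend p)
  rw [rcoevBend]
  simp only [monoidalComp, Category.assoc, comp_whiskerRight] at this ⊢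
  rw [← this]

lemma rcoev_injective {j Y W : C} {g g' : Y ⊗ dual j ⟶ W}
    (e : (𝟙 _ ⊗≫ Y ◁ rcoev j ⊗≫ g ▷ j : Y ⟶ _) = 𝟙 _ ⊗≫ Y ◁ rcoev j ⊗≫ g' ▷ j) : g = g' := by
  have key : ∀ g : Y ⊗ dual j ⟶ W,
      𝟙 _ ⊗≫ (𝟙 _ ⊗≫ Y ◁ rcoev j ⊗≫ g ▷ j : Y ⟶ _) ▷ dual j ⊗≫ W ◁ rev j ⊗≫ 𝟙 _ = g := by
    intro g
    calc
      _ = 𝟙 _ ⊗≫ Y ◁ rcoev j ▷ dual j ⊗≫ (g ▷ (j ⊗ dual j) ≫ W ◁ rev j) ⊗≫ 𝟙 _ := by monoidal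
      _ = 𝟙 _ ⊗≫ Y ◁ (rcoev j ▷ dual j ⊗≫ dual j ◁ rev j) ⊗≫ g ⊗≫ 𝟙 _ := by
        rw [← whisker_exchange]; monoidal
      _ = _ := by rw [rcoev_rev]; monoidal
  rw [← key g, e, key]

lemma exists_rcoev_comp {i : C} (f : 𝟙_ C ⟶ dual i ⊗ i) :
    ∃ g : i ⟶ i, f = rcoev i ≫ dual i ◁ g := by
  refine ⟨𝟙 _ ⊗≫ i ◁ f ⊗≫ rev i ▷ i ⊗≫ 𝟙 _, Eq.symm ?_⟩
  calc
    _ = 𝟙 _ ⊗≫ (rcoev i ▷ 𝟙_ C ≫ (dual i ⊗ i) ◁ f) ⊗≫ dual i ◁ rev i ▷ i ⊗≫ 𝟙 _ := by monoidal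
    _ = 𝟙 _ ⊗≫ f ⊗≫ (rcoev i ▷ dual i ⊗≫ dual i ◁ rev i) ▷ i ⊗≫ 𝟙 _ := by
      rw [← whisker_exchange]; monoidal
    _ = _ := by rw [rcoev_rev]; monoidal

/-- Evaluating on `j` straightens the bent `q`; the resulting `p ≫ q` sums to an identity over a
decomposition. -/
lemma bend_lev {i j Y : C} (q : j ⟶ i ⊗ Y) (p : i ⊗ Y ⟶ j) :
    dual i ◁ p ≫ bend q ▷ j ≫ (α_ _ _ _).hom ≫ Y ◁ lev j =
      dual i ◁ (p ≫ q) ≫ (α_ _ _ _).inv ≫ lev i ▷ Y ≫ (λ_ Y).hom ≫ (ρ_ Y).inv := by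
  rw [MonoidalCategory.whiskerLeft_comp, Category.assoc]
  congr 1
  dsimp only [bend]
  calc
    _ = 𝟙 _ ⊗≫ dual i ◁ lcoev j ▷ j ⊗≫ dual i ◁ q ▷ (dual j ⊗ j) ⊗≫
          (lev i ▷ (Y ⊗ dual j ⊗ j) ≫ 𝟙_ C ◁ (Y ◁ lev j)) ⊗≫ 𝟙 _ := by monoidal
    _ = 𝟙 _ ⊗≫ dual i ◁ lcoev j ▷ j ⊗≫ dual i ◁ (q ▷ (dual j ⊗ j) ≫ (i ⊗ Y) ◁ lev j) ⊗≫
          lev i ▷ Y ⊗≫ 𝟙 _ := by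
      rw [← whisker_exchange]; monoidal
    _ = 𝟙 _ ⊗≫ dual i ◁ (lcoev j ▷ j ⊗≫ j ◁ lev j) ⊗≫ dual i ◁ q ⊗≫ lev i ▷ Y ⊗≫ 𝟙 _ := by
      rw [← whisker_exchange]; monoidal
    _ = _ := by rw [lcoev_lev]; monoidal

lemma exists_curl {W i : C} (p : dual W ⟶ i) :
    ∃ h : dual i ⟶ W, rcoev W ≫ p ▷ W = lcoev i ≫ i ◁ h :=
  ⟨curl _, (lcoev_curl _).symm⟩

lemma rcoev_whiskerLeft_injective {W V : C} {g g' : W ⟶ V}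
    (e : rcoev W ≫ dual W ◁ g = rcoev W ≫ dual W ◁ g') : g = g' := by
  have key : ∀ g : W ⟶ V,
      𝟙 _ ⊗≫ W ◁ (rcoev W ≫ dual W ◁ g) ⊗≫ rev W ▷ V ⊗≫ 𝟙 _ = g := fun g => by
    calc
      _ = 𝟙 _ ⊗≫ W ◁ rcoev W ⊗≫ ((W ⊗ dual W) ◁ g ≫ rev W ▷ V) ⊗≫ 𝟙 _ := by monoidal
      _ = 𝟙 _ ⊗≫ (W ◁ rcoev W ⊗≫ rev W ▷ W) ⊗≫ g ⊗≫ 𝟙 _ := by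
        rw [whisker_exchange]; monoidal
      _ = _ := by rw [rev_rcoev]; monoidal
  rw [← key g, e, key]

end Zigzag

end FusionCenter

namespace FusionCenter

/-! ### Dimensions, decompositions into scalar objects, and the rotated decomposition of `Y ⊗ j^*`.
-/

section Linear

variable {C : Type u} [Category.{v} C] [MonoidalCategory C] [PivotalCategory C]
  [Preadditive C] [MonoidalPreadditive C] (k : Type w) [CommRing k] [Linear k C]
  [MonoidalLinear k C]

lemma bend_zero {i j Y : C} : bend (0 : j ⟶ i ⊗ Y) = 0 := by
  simp [bend]

lemma bend_smul {i j Y : C} (c : k) (q : j ⟶ i ⊗ Y) : bend (c • q) = c • bend q := by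
  simp [bend]

omit [Preadditive C] [MonoidalPreadditive C] in
lemma bend_injective {i j Y : C} : Function.Injective (bend : (j ⟶ i ⊗ Y) → _) :=
  Function.LeftInverse.injective unbend_bend

omit [PivotalCategory C] in
lemma unitCoeff_smul [HasFiniteBiproducts C] [IsFusionCategory k C] (f : 𝟙_ C ⟶ 𝟙_ C) :
    unitCoeff k f • 𝟙 (𝟙_ C) = f :=
  (Equiv.ofBijective _ (IsFusionCategory.scalar_unit (k := k) (C := C))).apply_symm_apply f

lemma rightDim_smul [HasFiniteBiproducts C] [IsFusionCategory k C] (X : C) :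
    rightDim k X • 𝟙 (𝟙_ C) = lcoev X ≫ rev X := by
  rw [rightDim, unitCoeff_smul]; simp [rightTrace]

lemma leftDim_smul [HasFiniteBiproducts C] [IsFusionCategory k C] (X : C) :
    leftDim k X • 𝟙 (𝟙_ C) = rcoev X ≫ lev X := by
  rw [leftDim, unitCoeff_smul]; simp [leftTrace]

variable [HasFiniteBiproducts C] [IsFusionCategory k C]

lemma leftDim_unit_mul_rightDim_unit : leftDim k (𝟙_ C) * rightDim k (𝟙_ C) = 1 := by
  apply (IsFusionCategory.scalar_unit (k := k) (C := C)).1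
  have h : rcoev (𝟙_ C) ≫ (lev (𝟙_ C) ≫ lcoev (𝟙_ C)) ≫ rev (𝟙_ C) = 𝟙 (𝟙_ C) := by
    -- Beside unit strands, evaluation followed by coevaluation is a zigzag, so the product of the
    -- two loops collapses.
    have h1 : lev (𝟙_ C) ≫ lcoev (𝟙_ C) = (ρ_ _).hom ≫ (λ_ _).inv := by
      calc
        _ = 𝟙 _ ⊗≫ (lev (𝟙_ C) ▷ 𝟙_ C ≫ 𝟙_ C ◁ lcoev (𝟙_ C)) ⊗≫ 𝟙 _ := by monoidal
        _ = 𝟙 _ ⊗≫ (dual (𝟙_ C) ◁ lcoev (𝟙_ C) ⊗≫ lev (𝟙_ C) ▷ dual (𝟙_ C)) ⊗≫ 𝟙 _ := by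
          rw [← whisker_exchange]; monoidal
        _ = _ := by rw [lev_lcoev]; monoidal
    rw [h1]
    have e := congrArg (fun f => (λ_ (𝟙_ C)).inv ≫ f ≫ (λ_ (𝟙_ C)).hom) (rev_rcoev (𝟙_ C))
    refine Eq.trans ?_ (e.trans ?_) <;> monoidal
  have h' : (rcoev (𝟙_ C) ≫ lev (𝟙_ C)) ≫ lcoev (𝟙_ C) ≫ rev (𝟙_ C) = 𝟙 (𝟙_ C) := by
    simpa using h
  rw [← leftDim_smul k, ← rightDim_smul k] at h'
  rw [mul_comm]
  simpa [mul_smul] using h'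

omit [PivotalCategory C] in
variable {k} in
include k in
lemma hom_eq_zero_of_ne {I : Finset C} (hI : IsRepresentativeSet k I) {i j : I} (h : i ≠ j)
    (g : (i : C) ⟶ j) : g = 0 := by
  refine IsFusionCategory.hom_eq_zero (hI.scalar _ i.2) (hI.scalar _ j.2) ⟨fun e => h ?_⟩ g
  exact Subtype.ext ((hI.existsUnique_iso (i : C) (hI.scalar _ i.2)).unique
    ⟨i.2, ⟨Iso.refl _⟩⟩ ⟨j.2, ⟨e⟩⟩)

omit [Preadditive C] [MonoidalPreadditive C] [HasFiniteBiproducts C] in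
/-- A morphism `i^* ⟶ j^*` is the dual of a morphism `j ⟶ i`. -/
lemma exists_dual_hom {i j : C} (f : dual i ⟶ dual j) :
    ∃ g : j ⟶ i, f = bend (g ≫ (ρ_ i).inv) ≫ (λ_ (dual j)).hom :=
  ⟨unbend (f ≫ (λ_ (dual j)).inv) ≫ (ρ_ i).hom, by simp [bend_unbend]⟩

variable {k} in
include k in
lemma dual_hom_eq_zero_of_ne {I : Finset C} (hI : IsRepresentativeSet k I) {i j : I} (h : i ≠ j)
    (f : dual (i : C) ⟶ dual (j : C)) : f = 0 := by
  obtain ⟨g, rfl⟩ := exists_dual_hom f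
  rw [hom_eq_zero_of_ne hI h.symm g]
  simp [bend_zero]

omit [HasFiniteBiproducts C] [IsFusionCategory k C] in
lemma exists_smul_id_dual {i : C} (hi : IsScalar k i) (f : dual i ⟶ dual i) :
    ∃ c : k, f = c • 𝟙 _ := by
  obtain ⟨g, rfl⟩ := exists_dual_hom f
  obtain ⟨c, rfl⟩ := hi.2 g
  exact ⟨c, by simp [bend_smul, bend_unit]⟩

/-- `lcoev_bend_cobend_rev` with both endomorphisms replaced by scalars. -/
lemma smul_rightDim_eq {i j Y : C} (q : j ⟶ i ⊗ Y) (p : i ⊗ Y ⟶ j) {a b : k}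
    (ha : bend q ≫ cobend p = a • 𝟙 _) (hb : q ≫ p = b • 𝟙 _) :
    a * rightDim k i = b * rightDim k j := by
  apply (IsFusionCategory.scalar_unit (k := k) (C := C)).1
  have := lcoev_bend_cobend_rev q p
  rw [ha, hb] at this
  simpa [mul_smul, rightDim_smul] using this

/-- Scalar objects are detected by the morphisms out of the duals of the elements of `I`. -/
lemma hom_ext_of_dual {I : Finset C} (hI : IsRepresentativeSet k I) {W V : C} {g g' : W ⟶ V}
    (h : ∀ (i : I) (f : dual (i : C) ⟶ W), f ≫ g = f ≫ g') : g = g' := by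
  -- `W` is bent to `dual W`, which is then decomposed; by `exists_curl`, each projection of `dual
  -- W` corresponds to a morphism from the dual of an element of `I` to `W`.
  apply rcoev_whiskerLeft_injective
  obtain ⟨P⟩ := nonempty_scalarPartition k hI (dual W)
  have key : ∀ g : W ⟶ V, rcoev W ≫ dual W ◁ g =
      ∑ a, (rcoev W ≫ P.p a ▷ W ≫ (P.label a : C) ◁ g) ≫ P.q a ▷ V := fun g => by
    have h1 : ∀ a, (rcoev W ≫ P.p a ▷ W ≫ (P.label a : C) ◁ g) ≫ P.q a ▷ V =
        rcoev W ≫ (P.p a ≫ P.q a) ▷ W ≫ dual W ◁ g := fun a => by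
      simp [whisker_exchange]
    simp only [h1, ← Preadditive.comp_sum, ← Preadditive.sum_comp, ← sum_whiskerRight, P.total]
    simp
  rw [key, key]
  refine Finset.sum_congr rfl fun a _ => ?_
  obtain ⟨f, hf⟩ := exists_curl (P.p a)
  rw [reassoc_of% hf, reassoc_of% hf, ← MonoidalCategory.whiskerLeft_comp,
    ← MonoidalCategory.whiskerLeft_comp, h]

omit [PivotalCategory C] in
-- The summands are indexed by all pairs `(j, a)`, padded with zero maps when the label of `a` is
-- not `j`. Targets then depend on `j` alone, and later sums over `i` and `j` can be exchanged. Only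
-- completeness is recorded, since orthogonality is never needed.
lemma exists_decomposition {I : Finset C} (hI : IsRepresentativeSet k I) (Y : C) :
    ∃ (n : ℕ) (p : ∀ j : I, Fin n → (Y ⟶ (j : C))) (q : ∀ j : I, Fin n → ((j : C) ⟶ Y)),
      ∑ j, ∑ a, p j a ≫ q j a = 𝟙 Y := by
  classical
  obtain ⟨P⟩ := nonempty_scalarPartition k hI Y
  refine ⟨P.n, fun j a => if h : P.label a = j then P.p a ≫ eqToHom (by rw [h]) else 0,
    fun j a => if h : P.label a = j then eqToHom (by rw [h]) ≫ P.q a else 0, ?_⟩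
  rw [Finset.sum_comm, ← P.total]
  refine Finset.sum_congr rfl fun a _ => ?_
  rw [Finset.sum_eq_single (P.label a)]
  · simp
  · intro j _ hj
    simp [hj.symm]
  · simp

omit [PivotalCategory C] in
variable {k} in
include k in
lemma sum_comp_of_decomposition {I : Finset C} (hI : IsRepresentativeSet k I) {Y : C} {n : ℕ}
    {p : ∀ j : I, Fin n → (Y ⟶ (j : C))} {q : ∀ j : I, Fin n → ((j : C) ⟶ Y)}
    (hpq : ∑ j, ∑ a, p j a ≫ q j a = 𝟙 Y) {j : I} (h : (j : C) ⟶ Y) :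
    ∑ a, h ≫ p j a ≫ q j a = h := by
  conv_rhs => rw [← Category.comp_id h, ← hpq, Preadditive.comp_sum]
  rw [Finset.sum_eq_single j]
  · rw [Preadditive.comp_sum]
  · intro l _ hl
    rw [Preadditive.comp_sum]
    refine Finset.sum_eq_zero fun a _ => ?_
    rw [← Category.assoc, hom_eq_zero_of_ne hI hl.symm (h ≫ p l a), zero_comp]
  · simp

section

variable {k} {I : Finset C} (hI : IsRepresentativeSet k I) {Y : C} {n : I → ℕ}
  {p : ∀ i j : I, Fin (n i) → ((i : C) ⊗ Y ⟶ (j : C))}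
  {q : ∀ i j : I, Fin (n i) → ((j : C) ⟶ (i : C) ⊗ Y)}
  (hpq : ∀ i, ∑ j, ∑ a, p i j a ≫ q i j a = 𝟙 _)

include hI in
-- Only the term `l = i` survives, because there are no nonzero morphisms between the duals of
-- distinct elements of `I`.
lemma bend_comp_sum_smul (c : I → k) {i j : I} (h : (j : C) ⟶ (i : C) ⊗ Y) :
    bend h ≫ (∑ l, c l • ∑ a, cobend (p l j a) ≫ bend (q l j a)) =
      c i • ∑ a, (bend h ≫ cobend (p i j a)) ≫ bend (q i j a) := by
  rw [Preadditive.comp_sum, Finset.sum_eq_single i]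
  · simp [Preadditive.comp_sum]
  · intro l _ hl
    rw [Linear.comp_smul, Preadditive.comp_sum]
    rw [Finset.sum_eq_zero, smul_zero]
    intro a _
    rw [← Category.assoc, dual_hom_eq_zero_of_ne hI hl.symm (bend h ≫ cobend (p l j a)),
      zero_comp]
  · simp

include hI hpq in
-- Termwise, `smul_rightDim_eq` converts the coefficient of `bend h ≫ cobend p_a` into that of `h ≫
-- p_a`; completeness then reassembles `h`.
lemma rightDim_smul_sum {i j : I} (h : (j : C) ⟶ (i : C) ⊗ Y) :
    rightDim k (i : C) • ∑ a, (bend h ≫ cobend (p i j a)) ≫ bend (q i j a) =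
      rightDim k (j : C) • bend h := by
  have key : ∀ a, rightDim k (i : C) • ((bend h ≫ cobend (p i j a)) ≫ bend (q i j a)) =
      rightDim k (j : C) • bend (h ≫ p i j a ≫ q i j a) := fun a => by
    obtain ⟨c, hc⟩ := exists_smul_id_dual k (hI.scalar _ i.2) (bend h ≫ cobend (p i j a))
    obtain ⟨b, hb⟩ := (hI.scalar _ j.2).2 (h ≫ p i j a)
    have e := smul_rightDim_eq k h (p i j a) hc hb.symm
    rw [hc, ← Category.assoc, ← hb, Linear.smul_comp, Linear.smul_comp, Category.id_comp,
      Category.id_comp, bend_smul, smul_smul, smul_smul, mul_comm, e, mul_comm]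
  rw [Finset.smul_sum, Finset.sum_congr rfl fun a _ => key a, ← Finset.smul_sum, ← bend_sum,
    sum_comp_of_decomposition hI (hpq i)]

include hI hpq in
/-- The morphisms `bend q_a`, together with suitable multiples of `cobend p_a`, decompose
`Y ⊗ j^*`. -/
lemma sum_rightDim_smul_cobend_bend (j : I) :
    ∑ i : I, rightDim k (i : C) • ∑ a, cobend (p i j a) ≫ bend (q i j a) =
      rightDim k (j : C) • 𝟙 (Y ⊗ dual (j : C)) := by
  -- It suffices to test on morphisms from `i^*`, and each of these is of the form `bend h`.
  refine hom_ext_of_dual k hI fun i f => ?_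
  rw [← bend_unbend f, bend_comp_sum_smul hI (fun i => rightDim k (i : C)),
    rightDim_smul_sum hI hpq]
  simp

omit [HasFiniteBiproducts C] [IsFusionCategory k C] in
lemma rcoevBend_sum_smul (c : I → k) (j : I) :
    ∑ i : I, c i • ∑ a, rcoevBend (q i j a) (p i j a) =
      (𝟙 _ ⊗≫ Y ◁ rcoev (j : C) ⊗≫
        (∑ i : I, c i • ∑ a, cobend (p i j a) ≫ bend (q i j a)) ▷ (j : C) : Y ⟶ _) := by
  simp only [rcoevBend_eq, monoidalComp, sum_whiskerRight, Preadditive.comp_sum,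
    MonoidalLinear.smul_whiskerRight, Linear.comp_smul]

include hI hpq in
lemma sum_rightDim_smul_rcoevBend (j : I) :
    ∑ i : I, rightDim k (i : C) • ∑ a, rcoevBend (q i j a) (p i j a) =
      rightDim k (j : C) • (𝟙 _ ⊗≫ Y ◁ rcoev (j : C) ⊗≫ 𝟙 _ : Y ⟶ (Y ⊗ dual (j : C)) ⊗ j) := by
  rw [rcoevBend_sum_smul (p := p) (q := q) (fun i => rightDim k (i : C)),
    sum_rightDim_smul_cobend_bend hI hpq]
  simp [monoidalComp]

include hI hpq in
-- A partial converse of the identity: composing with `bend h` isolates `c i`, which a nonzero `h`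
-- ties to `c j` through the right dimensions.
lemma mul_rightDim_of_sum_smul_rcoevBend (c : I → k) {i j : I}
    (e : ∑ i : I, c i • ∑ a, rcoevBend (q i j a) (p i j a) =
      c j • (𝟙 _ ⊗≫ Y ◁ rcoev (j : C) ⊗≫ 𝟙 _ : Y ⟶ (Y ⊗ dual (j : C)) ⊗ j))
    (h : (j : C) ⟶ (i : C) ⊗ Y) :
    (rightDim k (i : C) * c j) • h = (rightDim k (j : C) * c i) • h := by
  rw [rcoevBend_sum_smul (p := p) (q := q)] at e
  have e1 : ∑ i : I, c i • ∑ a, cobend (p i j a) ≫ bend (q i j a) =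
      c j • 𝟙 (Y ⊗ dual (j : C)) := by
    apply rcoev_injective
    rw [e]
    simp [monoidalComp]
  have e2 := congrArg (fun f => rightDim k (i : C) • (bend h ≫ f)) e1
  rw [bend_comp_sum_smul hI, smul_comm, rightDim_smul_sum hI hpq] at e2
  apply bend_injective
  rw [bend_smul, bend_smul, mul_comm (rightDim k (j : C)), mul_smul, mul_smul, e2]
  simp

end

end Linear

end FusionCenter

namespace FusionCenter

/-! ### Counit and section components for a half braiding. -/

section HalfBraiding

variable {C : Type u} [Category.{v} C] [MonoidalCategory C]

/-- Multiplicativity at `𝟙 ⊗ 𝟙` makes `σ_𝟙` idempotent up to unit isomorphisms; being invertible, it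
is canonical. -/
lemma halfBraiding_unit {A : C} (σ : HalfBraiding A) :
    (σ.β (𝟙_ C)).hom = (ρ_ A).hom ≫ (λ_ A).inv := by
  have h1 := σ.naturality (λ_ (𝟙_ C)).hom
  rw [σ.monoidal] at h1
  have h2 : (σ.β (𝟙_ C)).hom =
      (σ.β (𝟙_ C)).hom ≫ (λ_ A).hom ≫ (ρ_ A).inv ≫ (σ.β (𝟙_ C)).hom := by
    calc
      _ = A ◁ (λ_ (𝟙_ C)).inv ≫ A ◁ (λ_ (𝟙_ C)).hom ≫ (σ.β (𝟙_ C)).hom := by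
        rw [← MonoidalCategory.whiskerLeft_comp_assoc, Iso.inv_hom_id,
          MonoidalCategory.whiskerLeft_id, Category.id_comp]
      _ = 𝟙 _ ⊗≫ (σ.β (𝟙_ C)).hom ▷ 𝟙_ C ⊗≫ 𝟙_ C ◁ (σ.β (𝟙_ C)).hom ⊗≫ 𝟙 _ := by
        rw [h1]; monoidal
      _ = _ := by monoidal
  have h3 := (cancel_epi (σ.β (𝟙_ C)).hom).1 ((Category.comp_id _).trans h2)
  rw [← cancel_epi (ρ_ A).inv, ← cancel_epi (λ_ A).hom, ← h3]
  simp

variable [PivotalCategory C]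

/-- The component `i^* ⊗ A ⊗ i ⟶ A` of the counit of the free half braiding adjunction. -/
def counitComp {A : C} (σ : HalfBraiding A) (i : C) : dual i ⊗ (A ⊗ i) ⟶ A :=
  dual i ◁ (σ.β i).hom ≫ (α_ _ _ _).inv ≫ lev i ▷ A ≫ (λ_ _).hom

/-- The component `A ⟶ i^* ⊗ A ⊗ i` of the averaging section of the counit. -/
def sectionComp {A : C} (σ : HalfBraiding A) (i : C) : A ⟶ dual i ⊗ (A ⊗ i) :=
  (ρ_ _).inv ≫ A ◁ rcoev i ≫ (α_ _ _ _).inv ≫ (σ.β (dual i)).hom ▷ i ≫ (α_ _ _ _).hom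

lemma sectionComp_counitComp {A : C} (σ : HalfBraiding A) (i : C) :
    sectionComp σ i ≫ counitComp σ i = (ρ_ _).inv ≫ A ◁ (rcoev i ≫ lev i) ≫ (ρ_ _).hom := by
  have h := σ.naturality (lev i)
  rw [σ.monoidal, halfBraiding_unit] at h
  calc
    _ = (ρ_ _).inv ≫ A ◁ rcoev i ≫ (((α_ _ _ _).inv ≫ (σ.β (dual i)).hom ▷ i ≫
        (α_ _ _ _).hom ≫ dual i ◁ (σ.β i).hom ≫ (α_ _ _ _).inv) ≫ lev i ▷ A) ≫
        (λ_ _).hom := by simp [sectionComp, counitComp]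
    _ = _ := by rw [← h]; simp

/-- The morphism `A ⊗ Y ⟶ Y ⊗ j^* ⊗ A ⊗ j` obtained by braiding `A` past a morphism
`Y ⟶ Y ⊗ j^* ⊗ j`. -/
def braidPast {A : C} (σ : HalfBraiding A) {j Y : C} (f : Y ⟶ (Y ⊗ dual j) ⊗ j) :
    A ⊗ Y ⟶ Y ⊗ (dual j ⊗ (A ⊗ j)) :=
  A ◁ f ≫ (α_ _ _ _).inv ≫ (σ.β (Y ⊗ dual j)).hom ▷ j ≫ (α_ _ _ _).hom ≫ (α_ _ _ _).hom

/-- Naturality of `σ` at `bend q` pulls `A` out of the diagram. With `halfBraiding_sectionComp`,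
centrality of the averaged section reduces to a statement about morphisms `Y ⟶ Y ⊗ j^* ⊗ j`. -/
lemma sectionComp_bendMap {A : C} (σ : HalfBraiding A) {i j Y : C} (q : j ⟶ i ⊗ Y)
    (p : i ⊗ Y ⟶ j) :
    sectionComp σ i ▷ Y ≫ bendMap A q p = braidPast σ (rcoevBend q p) := by
  have h := σ.naturality (bend q)
  dsimp only [sectionComp, bendMap, braidPast, rcoevBend]
  calc
    _ = 𝟙 _ ⊗≫ A ◁ rcoev i ▷ Y ⊗≫ ((σ.β (dual i)).hom ▷ (i ⊗ Y) ≫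
          (dual i ⊗ A) ◁ p) ⊗≫ bend q ▷ (A ⊗ j) ⊗≫ 𝟙 _ := by monoidal
    _ = 𝟙 _ ⊗≫ A ◁ rcoev i ▷ Y ⊗≫ A ◁ dual i ◁ p ⊗≫
          ((σ.β (dual i)).hom ≫ bend q ▷ A) ▷ j ⊗≫ 𝟙 _ := by
      rw [← whisker_exchange]; monoidal
    _ = _ := by rw [← h]; monoidal

lemma halfBraiding_sectionComp {A : C} (σ : HalfBraiding A) (j Y : C) :
    (σ.β Y).hom ≫ Y ◁ sectionComp σ j =
      braidPast σ (𝟙 _ ⊗≫ Y ◁ rcoev j ⊗≫ 𝟙 _ : Y ⟶ (Y ⊗ dual j) ⊗ j) := by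
  dsimp only [sectionComp, braidPast]
  rw [σ.monoidal]
  calc
    _ = 𝟙 _ ⊗≫ ((σ.β Y).hom ▷ 𝟙_ C ≫ (Y ⊗ A) ◁ rcoev j) ⊗≫
          Y ◁ (σ.β (dual j)).hom ▷ j ⊗≫ 𝟙 _ := by monoidal
    _ = _ := by rw [← whisker_exchange]; monoidal

/-- This normal form differs from that of `counitComp_halfBraiding` only by the factor `p ≫ q`, so
summing over a decomposition shows that the counit is central. -/
lemma bendMap_counitComp {A : C} (σ : HalfBraiding A) {i j Y : C} (q : j ⟶ i ⊗ Y)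
    (p : i ⊗ Y ⟶ j) :
    bendMap A q p ≫ Y ◁ counitComp σ j =
      (α_ _ _ _).hom ≫ dual i ◁ ((α_ _ _ _).hom ≫ (σ.β (i ⊗ Y)).hom ≫ (p ≫ q) ▷ A) ≫
        𝟙 _ ⊗≫ lev i ▷ (Y ⊗ A) ⊗≫ 𝟙 _ := by
  have h := σ.naturality p
  have h' := bend_lev q p
  dsimp only [counitComp, bendMap]
  calc
    _ = 𝟙 _ ⊗≫ dual i ◁ A ◁ p ⊗≫ (bend q ▷ (A ⊗ j) ≫ (Y ⊗ dual j) ◁ (σ.β j).hom) ⊗≫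
          Y ◁ lev j ▷ A ⊗≫ 𝟙 _ := by monoidal
    _ = 𝟙 _ ⊗≫ dual i ◁ (A ◁ p ≫ (σ.β j).hom) ⊗≫ bend q ▷ (j ⊗ A) ⊗≫
          Y ◁ lev j ▷ A ⊗≫ 𝟙 _ := by
      rw [← whisker_exchange]; monoidal
    _ = 𝟙 _ ⊗≫ dual i ◁ (σ.β (i ⊗ Y)).hom ⊗≫
          (dual i ◁ p ≫ bend q ▷ j ≫ (α_ _ _ _).hom ≫ Y ◁ lev j) ▷ A ⊗≫ 𝟙 _ := by
      rw [h]; monoidal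
    _ = _ := by rw [h']; monoidal

lemma counitComp_halfBraiding {A : C} (σ : HalfBraiding A) (i Y : C) :
    counitComp σ i ▷ Y ≫ (σ.β Y).hom =
      (α_ _ _ _).hom ≫ dual i ◁ ((α_ _ _ _).hom ≫ (σ.β (i ⊗ Y)).hom) ≫
        𝟙 _ ⊗≫ lev i ▷ (Y ⊗ A) ⊗≫ 𝟙 _ := by
  rw [σ.monoidal]
  dsimp only [counitComp]
  calc
    _ = 𝟙 _ ⊗≫ dual i ◁ (σ.β i).hom ▷ Y ⊗≫ (lev i ▷ (A ⊗ Y) ≫ 𝟙_ C ◁ (σ.β Y).hom) ⊗≫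
          𝟙 _ := by monoidal
    _ = _ := by rw [← whisker_exchange]; monoidal

end HalfBraiding

/-! ### The averaging section of the counit; invertible dimension gives retracts. -/

section Free

variable {C : Type u} [Category.{v} C] [MonoidalCategory C] [PivotalCategory C]
  [Preadditive C] [MonoidalPreadditive C] {k : Type w} [CommRing k] [Linear k C]
  [MonoidalLinear k C] [HasFiniteBiproducts C] [IsFusionCategory k C]
  {I : Finset C} (hI : IsRepresentativeSet k I)

/-- The free half braiding can be computed from any decompositions. -/
lemma freeι_freeBraid_eq (X Y : C) (i : I) {B : Type*} [Fintype B] (m : B → I)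
    (p : ∀ b, (i : C) ⊗ Y ⟶ (m b : C)) (q : ∀ b, (m b : C) ⟶ (i : C) ⊗ Y)
    (hpq : ∑ b, p b ≫ q b = 𝟙 _) :
    freeι X i ▷ Y ≫ freeBraid k hI X Y = ∑ b, bendMap X (q b) (p b) ≫ Y ◁ freeι X (m b) := by
  have := sum_bendMap_change k hI X (𝟙 ((i : C) ⊗ Y)) _ _ _
    (partition k hI ((i : C) ⊗ Y)).q (partition k hI ((i : C) ⊗ Y)).total p q hpq
  simp only [Category.id_comp, Category.comp_id] at this
  rw [freeι_freeBraid, this]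

/-- Families of morphisms out of the summands define morphisms out of `Z(X)`. -/
noncomputable def freeDesc {X W : C} (f : ∀ i : I, dual (i : C) ⊗ (X ⊗ (i : C)) ⟶ W) :
    freeObj I X ⟶ W := ∑ i, freeπ X i ≫ f i

omit [MonoidalPreadditive C] in
lemma freeι_freeDesc {X W : C} (f : ∀ i : I, dual (i : C) ⊗ (X ⊗ (i : C)) ⟶ W) (i : I) :
    freeι X i ≫ freeDesc f = f i := by
  classical
  rw [freeDesc, Preadditive.comp_sum, Finset.sum_eq_single i]
  · rw [← Category.assoc, freeι_freeπ_self, Category.id_comp]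
  · intro j _ hj
    rw [← Category.assoc, freeι_freeπ_ne X hj.symm, zero_comp]
  · simp

omit [MonoidalPreadditive C] in
lemma sum_freeπ_freeι_comp {X V W : C} (s : V ⟶ freeObj I X) (e : freeObj I X ⟶ W) :
    ∑ i : I, (s ≫ freeπ X i) ≫ freeι X i ≫ e = s ≫ e := by
  have h : ∀ i : I, (s ≫ freeπ X i) ≫ freeι X i ≫ e = s ≫ (freeπ X i ≫ freeι X i) ≫ e :=
    fun i => by simp
  simp only [h, ← Preadditive.comp_sum, ← Preadditive.sum_comp, free_total, Category.id_comp]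

lemma freeDesc_counitComp_comm {A : C} (σ : HalfBraiding A) (Y : C) :
    (freeDesc (I := I) fun i => counitComp σ (i : C)) ▷ Y ≫ (σ.β Y).hom =
      freeBraid k hI A Y ≫ Y ◁ freeDesc (I := I) fun i => counitComp σ (i : C) := by
  refine free_hom_ext fun i => ?_
  rw [← Category.assoc, ← Category.assoc, ← comp_whiskerRight, freeι_freeDesc,
    freeι_freeBraid, counitComp_halfBraiding, Preadditive.sum_comp]
  have h : ∀ a, (bendMap A ((partition k hI ((i : C) ⊗ Y)).q a)
      ((partition k hI ((i : C) ⊗ Y)).p a) ≫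
        Y ◁ freeι A ((partition k hI ((i : C) ⊗ Y)).label a)) ≫
          Y ◁ freeDesc (I := I) (fun i => counitComp σ (i : C)) = _ := fun a => by
    rw [Category.assoc, ← MonoidalCategory.whiskerLeft_comp, freeι_freeDesc, bendMap_counitComp]
  rw [Finset.sum_congr rfl fun a _ => h a]
  simp only [← Preadditive.comp_sum, ← Preadditive.sum_comp, ← whiskerLeft_sum,
    ← sum_whiskerRight, (partition k hI ((i : C) ⊗ Y)).total]
  simp

omit [HasFiniteBiproducts C] [IsFusionCategory k C] in
lemma braidPast_smul {A : C} (σ : HalfBraiding A) {j Y : C} (c : k) (f : Y ⟶ (Y ⊗ dual j) ⊗ j) :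
    braidPast σ (c • f) = c • braidPast σ f := by
  simp [braidPast]

omit [HasFiniteBiproducts C] in
lemma braidPast_sum {A : C} (σ : HalfBraiding A) {j Y : C} {B : Type*} (s : Finset B)
    (f : B → (Y ⟶ (Y ⊗ dual j) ⊗ j)) :
    braidPast σ (∑ a ∈ s, f a) = ∑ a ∈ s, braidPast σ (f a) := by
  simp only [braidPast, whiskerLeft_sum, Preadditive.sum_comp]

lemma averaging_comm {A : C} (σ : HalfBraiding A) (Y : C) :
    (∑ i : I, rightDim k (i : C) • sectionComp σ (i : C) ≫ freeι A i) ▷ Y ≫ freeBraid k hI A Y =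
      (σ.β Y).hom ≫ Y ◁ ∑ i : I, rightDim k (i : C) • sectionComp σ (i : C) ≫ freeι A i := by
  choose n p q hpq using fun i : I => exists_decomposition k hI ((i : C) ⊗ Y)
  have h1 : ∀ i : I, (rightDim k (i : C) • sectionComp σ (i : C) ≫ freeι A i) ▷ Y ≫
      freeBraid k hI A Y = ∑ j : I, braidPast σ (rightDim k (i : C) •
        ∑ a, rcoevBend (q i j a) (p i j a)) ≫ Y ◁ freeι A j := fun i => by
    have hpq' := hpq i
    rw [← Fintype.sum_prod_type'] at hpq'
    rw [MonoidalLinear.smul_whiskerRight, comp_whiskerRight, Linear.smul_comp, Category.assoc,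
      freeι_freeBraid_eq hI A Y i (fun x : I × Fin (n i) => x.1) (fun x => p i x.1 x.2)
        (fun x => q i x.1 x.2) hpq', Fintype.sum_prod_type, Preadditive.comp_sum,
      Finset.smul_sum]
    refine Finset.sum_congr rfl fun j _ => ?_
    rw [braidPast_smul, braidPast_sum, Linear.smul_comp, Preadditive.comp_sum,
      Preadditive.sum_comp]
    congr 1
    refine Finset.sum_congr rfl fun a _ => ?_
    rw [← Category.assoc, sectionComp_bendMap]
  -- The target summand `j` is fixed and the source `i` is summed first, which is the shape of
  -- `sum_rightDim_smul_rcoevBend`.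
  rw [sum_whiskerRight, Preadditive.sum_comp, Finset.sum_congr rfl fun i _ => h1 i,
    Finset.sum_comm, whiskerLeft_sum, Preadditive.comp_sum]
  refine Finset.sum_congr rfl fun j _ => ?_
  rw [← Preadditive.sum_comp, ← braidPast_sum, sum_rightDim_smul_rcoevBend hI hpq,
    braidPast_smul, ← halfBraiding_sectionComp]
  simp

lemma averaging_counit {A : C} (σ : HalfBraiding A) :
    (∑ i : I, rightDim k (i : C) • sectionComp σ (i : C) ≫ freeι A i) ≫
      (freeDesc (I := I) fun i => counitComp σ (i : C)) = categoryDim k I • 𝟙 A := by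
  rw [Preadditive.sum_comp, categoryDim,
    ← Finset.sum_coe_sort I (fun i => leftDim k i * rightDim k i),
    Finset.sum_smul]
  refine Finset.sum_congr rfl fun i _ => ?_
  rw [Linear.smul_comp, Category.assoc, freeι_freeDesc, sectionComp_counitComp, ← leftDim_smul k,
    mul_comm, mul_smul]
  simp

/-- If the dimension is invertible, every half braiding is a retract of the free half braiding on
its underlying object. -/
lemma nonempty_retract_of_isUnit (h : IsUnit (categoryDim k I)) (M : Center C) :
    ∃ X : C, Nonempty (Retract M (freeHalfBraiding k hI X)) := by
  obtain ⟨A, σ⟩ := M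
  obtain ⟨c, hc⟩ := h.exists_left_inv
  let s : A ⟶ freeObj I A :=
    c • ∑ i : I, rightDim k (i : C) • sectionComp σ (i : C) ≫ freeι A i
  let e : freeObj I A ⟶ A := freeDesc (I := I) fun i => counitComp σ (i : C)
  have hs : ∀ Y, s ▷ Y ≫ freeBraid k hI A Y = (σ.β Y).hom ≫ Y ◁ s := fun Y => by
    rw [MonoidalLinear.smul_whiskerRight, MonoidalLinear.whiskerLeft_smul, Linear.smul_comp,
      Linear.comp_smul, averaging_comm]
  have hse : s ≫ e = 𝟙 A := by
    rw [Linear.smul_comp, averaging_counit, smul_smul, hc, one_smul]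
  exact ⟨A, ⟨{ i := ⟨s, hs⟩
               r := ⟨e, freeDesc_counitComp_comm hI σ⟩
               retract := Center.ext _ _ hse }⟩⟩

end Free

end FusionCenter

namespace FusionCenter

/-! ### Converse: diagrams for morphisms between the unit object and a free half braiding. -/

section Zigzag

variable {C : Type u} [Category.{v} C] [MonoidalCategory C] [PivotalCategory C]

/-- The half braiding with `Y = i` carries the summand of `𝟙` to that of `i`, since `𝟙 ⊗ i` is
isomorphic to `i`; this transports `lcoev 𝟙` to `lcoev i`. -/
lemma lcoev_unit_bendMap (X i : C) :
    (𝟙 (X ⊗ i) ⊗≫ lcoev (𝟙_ C) ▷ (X ⊗ i) ⊗≫ bendMap X (λ_ i).inv (λ_ i).hom :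
      X ⊗ i ⟶ i ⊗ (dual i ⊗ (X ⊗ i))) = 𝟙 _ ⊗≫ lcoev i ▷ (X ⊗ i) ⊗≫ 𝟙 _ := by
  dsimp only [bendMap]
  calc
    _ = 𝟙 _ ⊗≫ (lcoev (𝟙_ C) ≫ 𝟙_ C ◁ bend (λ_ i).inv) ▷ (X ⊗ i) ⊗≫ 𝟙 _ := by monoidal
    _ = _ := by rw [lcoev_bend]; monoidal

lemma lcoev_whiskerLeft_lev {X i : C} (t : X ⟶ 𝟙_ C) :
    (lcoev i ▷ (X ⊗ i) ⊗≫ i ◁ (dual i ◁ (t ▷ i ≫ (λ_ i).hom) ≫ lev i) :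
      𝟙_ C ⊗ (X ⊗ i) ⟶ i ⊗ 𝟙_ C) = 𝟙 _ ⊗≫ t ▷ i ⊗≫ 𝟙 _ := by
  calc
    _ = 𝟙 _ ⊗≫ (lcoev i ▷ (X ⊗ i) ≫ (i ⊗ dual i) ◁ (t ▷ i)) ⊗≫ i ◁ lev i ⊗≫ 𝟙 _ := by
      monoidal
    _ = 𝟙 _ ⊗≫ t ▷ i ⊗≫ (lcoev i ▷ i ⊗≫ i ◁ lev i) ⊗≫ 𝟙 _ := by
      rw [← whisker_exchange]; monoidal
    _ = _ := by rw [lcoev_lev]; monoidal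

/-- A family compatible with the free half braiding at the summand of the unit object is
determined by its value there. -/
lemma eq_whiskerLeft_lev_of_bendMap {X i : C} (e₁ : dual (𝟙_ C) ⊗ (X ⊗ 𝟙_ C) ⟶ 𝟙_ C)
    (e : dual i ⊗ (X ⊗ i) ⟶ 𝟙_ C)
    (h : e₁ ▷ i ≫ (λ_ i).hom ≫ (ρ_ i).inv = bendMap X (λ_ i).inv (λ_ i).hom ≫ i ◁ e) :
    e = dual i ◁ ((𝟙 X ⊗≫ lcoev (𝟙_ C) ▷ X ⊗≫ e₁) ▷ i ≫ (λ_ i).hom) ≫ lev i := by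
  apply lcoev_whiskerRight_left_injective
  rw [lcoev_whiskerLeft_lev]
  calc
    _ = 𝟙 _ ⊗≫ (𝟙 (X ⊗ i) ⊗≫ lcoev i ▷ (X ⊗ i) ⊗≫ 𝟙 (i ⊗ (dual i ⊗ (X ⊗ i)))) ≫ i ◁ e := by
      monoidal
    _ = 𝟙 _ ⊗≫ lcoev (𝟙_ C) ▷ (X ⊗ i) ⊗≫
          (bendMap X (λ_ i).inv (λ_ i).hom ≫ i ◁ e) := by
      rw [← lcoev_unit_bendMap]; monoidal
    _ = _ := by rw [← h]; monoidal

lemma whiskerRight_bendMap_whiskerLeft {X i j Y : C} (t : X ⟶ 𝟙_ C)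
    (s : 𝟙_ C ⟶ dual i ⊗ (X ⊗ i)) (q : j ⟶ i ⊗ Y) (p : i ⊗ Y ⟶ j) :
    s ▷ Y ≫ bendMap X q p ≫ Y ◁ dual j ◁ (t ▷ j ≫ (λ_ j).hom) =
      𝟙 _ ⊗≫ (s ≫ dual i ◁ (t ▷ i ≫ (λ_ i).hom)) ▷ Y ⊗≫ dual i ◁ p ≫ bend q ▷ j ⊗≫ 𝟙 _ := by
  dsimp only [bendMap]
  calc
    _ = 𝟙 _ ⊗≫ s ▷ Y ⊗≫ dual i ◁ X ◁ p ⊗≫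
          (bend q ▷ (X ⊗ j) ≫ (Y ⊗ dual j) ◁ (t ▷ j)) ⊗≫ 𝟙 _ := by monoidal
    _ = 𝟙 _ ⊗≫ s ▷ Y ⊗≫ dual i ◁ (X ◁ p ≫ t ▷ j) ⊗≫ bend q ▷ j ⊗≫ 𝟙 _ := by
      rw [← whisker_exchange]; monoidal
    _ = _ := by rw [whisker_exchange]; monoidal

end Zigzag

/-! ### Converse: extracting scalars from a retraction onto the unit object. -/

section Free

variable {C : Type u} [Category.{v} C] [MonoidalCategory C] [PivotalCategory C]
  [Preadditive C] [MonoidalPreadditive C] {k : Type w} [CommRing k] [Linear k C]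
  [MonoidalLinear k C]

lemma smul_lcoev_injective {i : C} (hi : IsScalar k i) {a b : k}
    (h : a • lcoev i = b • lcoev i) : a = b := by
  apply hi.1
  have h1 := congrArg (fun f => (λ_ i).inv ≫ (f ▷ i ⊗≫ i ◁ lev i) ≫ (ρ_ i).hom) h
  have h2 : (λ_ i).inv ≫ (lcoev i ▷ i ⊗≫ i ◁ lev i) ≫ (ρ_ i).hom = 𝟙 i := by
    rw [lcoev_lev]; monoidal
  simp only [monoidalComp, MonoidalLinear.smul_whiskerRight, Linear.smul_comp, Linear.comp_smul]
    at h1 h2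
  rwa [h2] at h1

variable [HasFiniteBiproducts C] [IsFusionCategory k C]
  {I : Finset C} (hI : IsRepresentativeSet k I)

lemma exists_eq_whiskerLeft_lev {X : C} {e : freeObj I X ⟶ 𝟙_ C}
    (he : ∀ Y, e ▷ Y ≫ (λ_ Y).hom ≫ (ρ_ Y).inv = freeBraid k hI X Y ≫ Y ◁ e) :
    ∃ t : X ⟶ 𝟙_ C, ∀ i : I,
      freeι X i ≫ e = dual (i : C) ◁ (t ▷ (i : C) ≫ (λ_ (i : C)).hom) ≫ lev (i : C) := by
  refine ⟨_, fun i => eq_whiskerLeft_lev_of_bendMap (freeι X ⟨𝟙_ C, hI.unit_mem⟩ ≫ e) _ ?_⟩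
  -- Centrality of `e` is used only at `Y = i` and on the summand of `𝟙`, where the decomposition of
  -- `𝟙 ⊗ i` can be taken to be the unit isomorphism.
  have h := congrArg (fun f => freeι X ⟨𝟙_ C, hI.unit_mem⟩ ▷ (i : C) ≫ f) (he i)
  have h1 := freeι_freeBraid_eq hI X (i : C) ⟨𝟙_ C, hI.unit_mem⟩ (fun _ : Unit => i)
    (fun _ => (λ_ (i : C)).hom) (fun _ => (λ_ (i : C)).inv) (by simp)
  rw [reassoc_of% h1, ← Category.assoc, ← comp_whiskerRight] at h
  simpa using h

lemma exists_smul_rcoev {X : C} {s : 𝟙_ C ⟶ freeObj I X}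
    (hs : ∀ Y, s ▷ Y ≫ freeBraid k hI X Y = ((λ_ Y).hom ≫ (ρ_ Y).inv) ≫ Y ◁ s)
    (t : X ⟶ 𝟙_ C) :
    ∃ c : I → k, (∀ i : I, (s ≫ freeπ X i) ≫ dual (i : C) ◁ (t ▷ (i : C) ≫ (λ_ (i : C)).hom) =
        c i • rcoev (i : C)) ∧
      ∀ (Y : C) (n : I → ℕ) (p : ∀ i j : I, Fin (n i) → ((i : C) ⊗ Y ⟶ (j : C)))
        (q : ∀ i j : I, Fin (n i) → ((j : C) ⟶ (i : C) ⊗ Y))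
        (_ : ∀ i, ∑ j, ∑ a, p i j a ≫ q i j a = 𝟙 _) (j : I),
        ∑ i : I, c i • ∑ a, rcoevBend (q i j a) (p i j a) =
          c j • (𝟙 _ ⊗≫ Y ◁ rcoev (j : C) ⊗≫ 𝟙 _ : Y ⟶ (Y ⊗ dual (j : C)) ⊗ j) := by
  have hc : ∀ i : I, ∃ c : k, (s ≫ freeπ X i) ≫
      dual (i : C) ◁ (t ▷ (i : C) ≫ (λ_ (i : C)).hom) = c • rcoev (i : C) := fun i => by
    obtain ⟨g, hg⟩ := exists_rcoev_comp
      ((s ≫ freeπ X i) ≫ dual (i : C) ◁ (t ▷ (i : C) ≫ (λ_ (i : C)).hom))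
    obtain ⟨c, rfl⟩ := (hI.scalar _ i.2).2 g
    exact ⟨c, by rw [hg]; simp⟩
  choose c hc using hc
  refine ⟨c, hc, fun Y n p q hpq j => ?_⟩
  have h1 : ∀ i a, (s ≫ freeπ X i) ▷ Y ≫ bendMap X (q i j a) (p i j a) ≫
      Y ◁ dual (j : C) ◁ (t ▷ (j : C) ≫ (λ_ (j : C)).hom) =
      (λ_ Y).hom ≫ (c i • rcoevBend (q i j a) (p i j a)) ≫ (α_ _ _ _).hom := fun i a => by
    rw [whiskerRight_bendMap_whiskerLeft, hc]
    simp [rcoevBend, monoidalComp]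
  have h2 : ∀ i : I, (s ≫ freeπ X i) ▷ Y ≫ (freeι X i ▷ Y ≫ freeBraid k hI X Y) ≫
      Y ◁ (freeπ X j ≫ dual (j : C) ◁ (t ▷ (j : C) ≫ (λ_ (j : C)).hom)) =
      (λ_ Y).hom ≫ (c i • ∑ a, rcoevBend (q i j a) (p i j a)) ≫ (α_ _ _ _).hom := fun i => by
    have hpq' := hpq i
    rw [← Fintype.sum_prod_type'] at hpq'
    rw [freeι_freeBraid_eq hI X Y i (fun x : I × Fin (n i) => x.1) (fun x => p i x.1 x.2)
        (fun x => q i x.1 x.2) hpq', Fintype.sum_prod_type, Finset.smul_sum,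
      Preadditive.sum_comp, Preadditive.comp_sum, Preadditive.sum_comp, Preadditive.comp_sum,
      Finset.sum_eq_single j]
    · rw [Preadditive.sum_comp, Preadditive.comp_sum]
      refine Finset.sum_congr rfl fun a _ => ?_
      rw [← h1, Category.assoc, ← MonoidalCategory.whiskerLeft_comp, ← Category.assoc (freeι X j),
        freeι_freeπ_self, Category.id_comp]
    · intro l _ hl
      rw [Preadditive.sum_comp, Preadditive.comp_sum]
      refine Finset.sum_eq_zero fun a _ => ?_
      rw [Category.assoc, ← MonoidalCategory.whiskerLeft_comp, ← Category.assoc (freeι X l),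
        freeι_freeπ_ne X hl, zero_comp, MonoidalPreadditive.whiskerLeft_zero, comp_zero, comp_zero]
    · simp
  have h3 : ∑ i : I, (s ≫ freeπ X i) ▷ Y ≫ freeι X i ▷ Y = s ▷ Y := by
    simp only [← comp_whiskerRight, ← sum_whiskerRight, Category.assoc, ← Preadditive.comp_sum,
      free_total, Category.comp_id]
  -- Centrality of `s`, projected to the summand `j` and with `X` removed by `t`.
  have h4 := congrArg (fun f => f ≫ Y ◁ (freeπ X j ≫
    dual (j : C) ◁ (t ▷ (j : C) ≫ (λ_ (j : C)).hom))) (hs Y)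
  rw [← h3, Preadditive.sum_comp, Preadditive.sum_comp, Category.assoc,
    ← MonoidalCategory.whiskerLeft_comp, ← Category.assoc s, hc] at h4
  simp only [Category.assoc] at h2 h4
  rw [Finset.sum_congr rfl fun i _ => h2 i, ← Preadditive.comp_sum, cancel_epi,
    ← Preadditive.sum_comp] at h4
  rw [← cancel_mono (α_ _ _ _).hom, h4]
  simp [monoidalComp]

/-- If the unit object is a retract of a free half braiding, the dimension is invertible. -/
lemma isUnit_categoryDim_of_retract {X : C} {s : 𝟙_ C ⟶ freeObj I X}
    (hs : ∀ Y, s ▷ Y ≫ freeBraid k hI X Y = ((λ_ Y).hom ≫ (ρ_ Y).inv) ≫ Y ◁ s)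
    {e : freeObj I X ⟶ 𝟙_ C}
    (he : ∀ Y, e ▷ Y ≫ (λ_ Y).hom ≫ (ρ_ Y).inv = freeBraid k hI X Y ≫ Y ◁ e)
    (hse : s ≫ e = 𝟙 _) : IsUnit (categoryDim k I) := by
  obtain ⟨t, ht⟩ := exists_eq_whiskerLeft_lev hI he
  obtain ⟨c, hc, hsum⟩ := exists_smul_rcoev hI hs t
  let o : I := ⟨𝟙_ C, hI.unit_mem⟩
  -- Taking `Y = i^*` and `j = 𝟙` provides the test morphism `lcoev i`, on which scalars act
  -- faithfully.
  have h1 : ∀ i : I, rightDim k (i : C) * c o = rightDim k (𝟙_ C) * c i := fun i => by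
    choose n p q hpq using fun l : I => exists_decomposition k hI ((l : C) ⊗ dual (i : C))
    have := mul_rightDim_of_sum_smul_rcoevBend hI hpq c (hsum _ n p q hpq o)
      (lcoev (i : C))
    exact smul_lcoev_injective (hI.scalar _ i.2) this
  have h2 : ∑ i : I, c i * leftDim k (i : C) = 1 := by
    apply (IsFusionCategory.scalar_unit (k := k) (C := C)).1
    rw [← sum_freeπ_freeι_comp] at hse
    simp only [one_smul]
    refine Eq.trans ?_ hse
    rw [Finset.sum_smul]
    refine Finset.sum_congr rfl fun i _ => ?_
    rw [ht, ← Category.assoc, hc, mul_smul, leftDim_smul, Linear.smul_comp]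
  have h3 : categoryDim k I * c o = rightDim k (𝟙_ C) := by
    calc
      _ = ∑ i : I, leftDim k (i : C) * (rightDim k (i : C) * c o) := by
        rw [categoryDim, ← Finset.sum_coe_sort I (fun i => leftDim k i * rightDim k i),
          Finset.sum_mul]
        exact Finset.sum_congr rfl fun i _ => mul_assoc _ _ _
      _ = rightDim k (𝟙_ C) * ∑ i : I, c i * leftDim k (i : C) := by
        rw [Finset.mul_sum]
        exact Finset.sum_congr rfl fun i _ => by rw [h1]; ring
      _ = _ := by rw [h2, mul_one]
  -- The factor `dim_l(𝟙)` cancels the remaining `dim_r(𝟙)`.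
  refine IsUnit.of_mul_eq_one (c o * leftDim k (𝟙_ C)) ?_
  rw [← mul_assoc, h3, mul_comm, leftDim_unit_mul_rightDim_unit]

end Free

end FusionCenter

theorem mainTheorem3 {k : Type w} [CommRing k] {C : Type u} [Category.{v} C] [Preadditive C]
    [Linear k C] [MonoidalCategory C] [HasFiniteBiproducts C] [MonoidalPreadditive C]
    [MonoidalLinear k C] [FusionCenter.IsFusionCategory k C] [FusionCenter.PivotalCategory C]
    (I : Finset C) (hI : FusionCenter.IsRepresentativeSet k I) :
    IsUnit (FusionCenter.categoryDim k I) ↔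
      ∀ M : Center C, ∃ X : C, Nonempty (Retract M (FusionCenter.freeHalfBraiding k hI X)) := by
  refine ⟨FusionCenter.nonempty_retract_of_isUnit hI, fun h => ?_⟩
  -- The unit of the center alone is enough for the converse.
  obtain ⟨X, ⟨r⟩⟩ := h (𝟙_ (Center C))
  exact FusionCenter.isUnit_categoryDim_of_retract hI (s := r.i.f) (fun Y => r.i.comm Y)
    (e := r.r.f) (fun Y => r.r.comm Y) (congrArg Center.Hom.f r.retract)
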